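/- A tree diagram is a triple $(T_+,\sigma,T_-)$, where $T_+,T_-$ are finite full rooted plane binary trees with the same number $n$ of leaves and $\sigma$ is a bijection from the leaves of $T_+$ to the leaves of $T_-$ (a permutation of $\{1,\dots,n\}$, the leaves being numbered from left to right). Label the left edge of every caret by $0$ and the right edge by $1$; the branches of a tree are the binary words labelling the paths from the root to the leaves. If $\sigma$ maps the leaf with branch $u$ of $T_+$ to the leaf with branch $v$ of $T_-$, then $u\to v$ is called a branch of the diagram. The diagram represents the homeomorphism of the Cantor set $\{0,1\}^{\mathbb N}$ mapping $ux$ to $vx$ for every branch $u\to v$ and every infinite binary word $x$. Thompson's group $V$ consists of all homeomorphisms represented by tree diagrams, composed from left to right ($fg$ means first $f$, then $g$); $T\le V$ and $F\le T$ consist of those represented by a diagram in which $\sigma$ is, respectively, a cyclic permutation ($i\mapsto i+k \bmod n$ for some $k$) or the identity. A diagram is reduced if it has no pair of branches $u0\to v0$, $u1\to v1$. Every $g\in V$ is represented by a unique reduced diagram, and $\mathcal N(g)$ denotes the number of leaves of each of its trees. Let $x_0,x_1,c_1,\pi_0$ be the elements with the branches $x_0:\ 00\to 0,\ 01\to 10,\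 1\to 11$; $x_1:\ 0\to 0,\ 100\to 10,\ 101\to 110,\ 11\to 111$; $c_1:\ 0\to 10,\ 10\to 11,\ 11\to 0$; $\pi_0:\ 0\to 10,\ 10\to 0,\ 11\to 11$. Let $X=\{x_0,x_1\}$ if $\mathcal G=F$, $X=\{x_0,x_1,c_1\}$ if $\mathcal G=T$, and $X=\{x_0,x_1,c_1,\pi_0\}$ if $\mathcal G=V$. A word over $X$ is a finite sequence of elements of $X$ and their inverses, $\|w\|$ is the number of letters of a word $w$, and $|g|=|g|_X$ is the word length of $g\in\mathcal G$ with respect to the generating set $X$. **Proposition.** There exist real constants $\delta,D>0$ and a positive integer $Q$ such that, for each $\mathcal G\in\{F,T,V\}$ and each $g\in\mathcal G$ with $\mathcal N(g)\ge 4$, there is a word $w$ over $X$ such that $\|w\|<D|g|$, every prefix $w'$ of $w$ (including the empty word and $w$ itself) satisfies $|gw'|>\delta|g|$, and $$gw=x_0^{Q|g|}x_1^{-1}x_0^{-Q|g|+1}.$$ In other words, in the Cayley graph of $\mathcal G$ with respect to $X$ the path labelled by $w$ goes from $g$ to $x_0^{Q|g|}x_1^{-1}x_0^{-Q|g|+1}$,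 has length less than $D|g|$, and all of its vertices lie at distance greater than $\delta|g|$ from the identity. -/

import Mathlib

namespace Thompson

/-- Finite binary words; `false` is the letter `0`, `true` is the letter `1`. -/
abbrev BinWord : Type := List Bool

/-- The Cantor set: infinite binary words. For `u : BinWord` and `x : Cantor`, the infinite word
`ux` is written `u ++ₛ x`. -/
abbrev Cantor : Type := Stream' Bool

/-- Finite full rooted plane binary trees. -/
inductive FullTree : Type
  | leaf : FullTree
  | caret (l r : FullTree) : FullTree

/-- The branches of a tree (the words labelling the paths from the root to the leaves, where left
edges are labelled by `0` and right edges by `1`), listed from left to right. -/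
def FullTree.branches : FullTree → List BinWord
  | .leaf => [[]]
  | .caret l r => l.branches.map (List.cons false) ++ r.branches.map (List.cons true)

/-- A tree diagram `(T₊, σ, T₋)`. Here `T₊ = dom`, `T₋ = ran`, and the bijection `σ` from the leaves
of `T₊` to the leaves of `T₋` is recorded by the list of the branches `u → v` of the diagram, as
pairs `(u, v)`: the words `u` are the branches of `T₊` from left to right, and the words `v` are the
branches of `T₋`, each occurring once, in the order `σ(1), …, σ(n)`. -/
structure TreeDiagram : Type where
  dom : FullTree
  ran : FullTree
  branches : List (BinWord × BinWord)
  fst_eq : branches.map Prod.fst = dom.branches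
  snd_perm : (branches.map Prod.snd).Perm ran.branches

namespace TreeDiagram

/-- The number of leaves of each of the two trees. -/
def numLeaves (D : TreeDiagram) : ℕ := D.branches.length

/-- The diagram is reduced: there is no dipole `u0 → v0`, `u1 → v1`. -/
def IsReduced (D : TreeDiagram) : Prop :=
  ¬ ∃ u v : BinWord, (u ++ [false], v ++ [false]) ∈ D.branches ∧
    (u ++ [true], v ++ [true]) ∈ D.branches

/-- The permutation of the diagram is a cyclic permutation (`i ↦ i + k` modulo `n` for some `k`). -/
def IsCyclic (D : TreeDiagram) : Prop := (D.branches.map Prod.snd).IsRotated D.ran.branches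

/-- The permutation of the diagram is the identity. -/
def IsIdentity (D : TreeDiagram) : Prop := D.branches.map Prod.snd = D.ran.branches

end TreeDiagram

/-- The group of all bijections of the Cantor set, *composed from left to right*: the product `f * g`
is `f` followed by `g` (see `mul_apply`). -/
abbrev CantorPerm : Type := (Equiv.Perm Cantor)ᵐᵒᵖ

theorem mul_apply (f g : CantorPerm) (x : Cantor) :
    (f * g).unop x = g.unop (f.unop x) := rfl

/-- The tree diagram `D` represents `g`: for each branch `u → v` of `D`, the map `g` takes `ux` to
`vx` for every infinite binary word `x`. -/
def TreeDiagram.Represents (D : TreeDiagram) (g : CantorPerm) : Prop :=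
  ∀ p ∈ D.branches, ∀ x : Cantor, g.unop (p.1 ++ₛ x) = p.2 ++ₛ x

/-! ### Branches of trees -/

namespace FullTree

theorem exists_branch (T : FullTree) (x : Cantor) :
    ∃ u ∈ T.branches, ∃ y : Cantor, x = u ++ₛ y := by
  induction T generalizing x with
  | leaf => exact ⟨[], by simp [branches], x, rfl⟩
  | caret l r ihl ihr =>
    have hx : x = Stream'.cons x.head x.tail := (Stream'.eta x).symm
    cases hb : x.head with
    | false =>
      obtain ⟨u, hu, y, hy⟩ := ihl x.tail
      refine ⟨false :: u, by simp [branches, hu], y, ?_⟩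
      rw [hx, hb, hy]; rfl
    | true =>
      obtain ⟨u, hu, y, hy⟩ := ihr x.tail
      refine ⟨true :: u, by simp [branches, hu], y, ?_⟩
      rw [hx, hb, hy]; rfl

theorem branch_unique (T : FullTree) {u v : BinWord} (hu : u ∈ T.branches) (hv : v ∈ T.branches)
    {y z : Cantor} (h : u ++ₛ y = v ++ₛ z) : u = v ∧ y = z := by
  induction T generalizing u v with
  | leaf =>
    simp only [branches, List.mem_singleton] at hu hv
    subst hu hv
    exact ⟨rfl, h⟩
  | caret l r ihl ihr =>
    simp only [branches, List.mem_append, List.mem_map] at hu hv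
    rcases hu with ⟨u', hu', rfl⟩ | ⟨u', hu', rfl⟩ <;>
    rcases hv with ⟨v', hv', rfl⟩ | ⟨v', hv', rfl⟩ <;>
    rw [Stream'.cons_append_stream, Stream'.cons_append_stream] at h
    · obtain ⟨h1, h2⟩ := ihl hu' hv' (Stream'.cons_injective2 h).2
      exact ⟨by rw [h1], h2⟩
    · exact absurd (Stream'.cons_injective2 h).1 (by simp)
    · exact absurd (Stream'.cons_injective2 h).1 (by simp)
    · obtain ⟨h1, h2⟩ := ihr hu' hv' (Stream'.cons_injective2 h).2
      exact ⟨by rw [h1], h2⟩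

theorem nodup_branches (T : FullTree) : T.branches.Nodup := by
  induction T with
  | leaf => simp [branches]
  | caret l r ihl ihr =>
    rw [branches, List.nodup_append]
    refine ⟨ihl.map List.cons_injective, ihr.map List.cons_injective, ?_⟩
    intro a ha b hb hab
    simp only [List.mem_map] at ha hb
    obtain ⟨a', _, rfl⟩ := ha
    obtain ⟨b', _, rfl⟩ := hb
    simp at hab

/-- The tree obtained from `T` by attaching the tree `φ u` at each branch `u` of `T`. -/
def graft : FullTree → (BinWord → FullTree) → FullTree
  | .leaf, φ => φ []
  | .caret l r, φ => .caret (l.graft fun u => φ (false :: u)) (r.graft fun u => φ (true :: u))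

theorem branches_graft (T : FullTree) (φ : BinWord → FullTree) :
    (T.graft φ).branches = T.branches.flatMap fun u => (φ u).branches.map (u ++ ·) := by
  induction T generalizing φ with
  | leaf => simp [graft, branches]
  | caret l r ihl ihr =>
    simp [graft, branches, ihl, ihr, List.flatMap_map, List.map_flatMap, Function.comp_def]

theorem exists_common_graft (S T : FullTree) :
    ∃ φ ψ : BinWord → FullTree, S.graft φ = T.graft ψ := by
  induction S generalizing T with
  | leaf =>
    refine ⟨fun _ => T, fun _ => .leaf, ?_⟩
    have h : ∀ R : FullTree, R.graft (fun _ => .leaf) = R := by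
      intro R
      induction R with
      | leaf => rfl
      | caret l r ihl ihr => simp [graft, ihl, ihr]
    rw [h]; rfl
  | caret l r ihl ihr =>
    cases T with
    | leaf =>
      refine ⟨fun _ => .leaf, fun _ => .caret l r, ?_⟩
      have h : ∀ R : FullTree, R.graft (fun _ => .leaf) = R := by
        intro R
        induction R with
        | leaf => rfl
        | caret l r ihl ihr => simp [graft, ihl, ihr]
      rw [h]; rfl
    | caret l' r' =>
      obtain ⟨φl, ψl, hl⟩ := ihl l'
      obtain ⟨φr, ψr, hr⟩ := ihr r'
      refine ⟨fun u => if u.head? = some true then φr u.tail else φl u.tail,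
        fun u => if u.head? = some true then ψr u.tail else ψl u.tail, ?_⟩
      simp [graft, hl, hr]

end FullTree

/-! ### The bijection represented by a tree diagram -/

namespace TreeDiagram

theorem snd_mem (D : TreeDiagram) {p : BinWord × BinWord} (hp : p ∈ D.branches) :
    p.2 ∈ D.ran.branches := D.snd_perm.mem_iff.1 (List.mem_map_of_mem hp)

theorem fst_mem (D : TreeDiagram) {p : BinWord × BinWord} (hp : p ∈ D.branches) :
    p.1 ∈ D.dom.branches := D.fst_eq ▸ List.mem_map_of_mem hp

theorem nodup_fst (D : TreeDiagram) : (D.branches.map Prod.fst).Nodup :=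
  D.fst_eq ▸ D.dom.nodup_branches

theorem nodup_snd (D : TreeDiagram) : (D.branches.map Prod.snd).Nodup :=
  D.snd_perm.nodup_iff.2 D.ran.nodup_branches

theorem existsUnique_represents (D : TreeDiagram) : ∃! g : CantorPerm, D.Represents g := by
  have h1 : ∀ x : Cantor, ∃ p ∈ D.branches, ∃ y : Cantor, x = p.1 ++ₛ y := by
    intro x
    obtain ⟨u, hu, y, hy⟩ := D.dom.exists_branch x
    rw [← D.fst_eq, List.mem_map] at hu
    obtain ⟨p, hp, rfl⟩ := hu
    exact ⟨p, hp, y, hy⟩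
  choose P hP Y hY using h1
  have key : ∀ p ∈ D.branches, ∀ y : Cantor, P (p.1 ++ₛ y) = p ∧ Y (p.1 ++ₛ y) = y := by
    intro p hp y
    obtain ⟨h2, h3⟩ := D.dom.branch_unique (D.fst_mem hp) (D.fst_mem (hP (p.1 ++ₛ y)))
      (hY (p.1 ++ₛ y))
    exact ⟨(List.inj_on_of_nodup_map D.nodup_fst hp (hP _) h2).symm, h3.symm⟩
  let f : Cantor → Cantor := fun x => (P x).2 ++ₛ Y x
  have hf : ∀ p ∈ D.branches, ∀ y : Cantor, f (p.1 ++ₛ y) = p.2 ++ₛ y := by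
    intro p hp y
    obtain ⟨h2, h3⟩ := key p hp y
    simp only [f, h2, h3]
  have hbij : Function.Bijective f := by
    constructor
    · intro x x' hxx'
      obtain ⟨h2, h3⟩ := D.ran.branch_unique (D.snd_mem (hP x)) (D.snd_mem (hP x')) hxx'
      rw [hY x, hY x', List.inj_on_of_nodup_map D.nodup_snd (hP x) (hP x') h2, h3]
    · intro z
      obtain ⟨v, hv, y, rfl⟩ := D.ran.exists_branch z
      rw [← D.snd_perm.mem_iff, List.mem_map] at hv
      obtain ⟨p, hp, rfl⟩ := hv
      exact ⟨p.1 ++ₛ y, hf p hp y⟩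
  refine ⟨MulOpposite.op (Equiv.ofBijective f hbij), fun p hp y => hf p hp y, ?_⟩
  intro g hg
  apply MulOpposite.unop_injective
  ext1 x
  change g.unop x = f x
  rw [hY x, hg _ (hP x), hf _ (hP x)]

/-- The bijection of the Cantor set represented by a tree diagram. -/
noncomputable def toPerm (D : TreeDiagram) : CantorPerm := D.existsUnique_represents.choose

theorem represents_toPerm (D : TreeDiagram) : D.Represents D.toPerm :=
  D.existsUnique_represents.choose_spec.1

theorem Represents.eq_toPerm {D : TreeDiagram} {g : CantorPerm} (h : D.Represents g) :
    g = D.toPerm := D.existsUnique_represents.choose_spec.2 g h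

end TreeDiagram

/-! ### The groups

The closure properties are proved simultaneously for the three kinds of permutations, that is, for
the relations "permutation", "rotation" and "equality" between lists of words. -/

/-- The properties of the relations "permutation", "rotation" and "equality" used below. -/
structure IsListRel (r : List BinWord → List BinWord → Prop) : Prop where
  refl : ∀ l, r l l
  symm : ∀ {l l'}, r l l' → r l' l
  trans : ∀ {l l' l''}, r l l' → r l' l'' → r l l''
  flatMap : ∀ {l l'} (f : BinWord → List BinWord), r l l' → r (l.flatMap f) (l'.flatMap f)
  perm : ∀ {l l'}, r l l' → l.Perm l'

theorem IsListRel.map {r : List BinWord → List BinWord → Prop} (hr : IsListRel r)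
    {l l' : List BinWord} (f : BinWord → BinWord) (h : r l l') : r (l.map f) (l'.map f) := by
  rw [List.map_eq_flatMap, List.map_eq_flatMap]
  exact hr.flatMap (fun u => [f u]) h

theorem isListRel_perm : IsListRel List.Perm :=
  ⟨List.Perm.refl, fun h => h.symm, fun h h' => h.trans h', fun f h => h.flatMap_right f, id⟩

theorem isListRel_isRotated : IsListRel List.IsRotated := by
  refine ⟨List.IsRotated.refl, fun h => h.symm, fun h h' => h.trans h', ?_, fun h => h.perm⟩
  rintro l l' f h
  obtain ⟨n, hn, rfl⟩ := List.isRotated_iff_mod.1 h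
  rw [List.rotate_eq_drop_append_take hn, List.flatMap_append]
  conv_lhs => rw [← List.take_append_drop n l, List.flatMap_append]
  exact List.isRotated_append

theorem isListRel_eq : IsListRel Eq :=
  ⟨fun _ => rfl, fun h => h.symm, fun h h' => h.trans h', fun _ h => h ▸ rfl, fun h => h ▸ .refl _⟩

theorem exists_lookup {α β γ : Type} (L : List α) (f : α → β) (g : α → γ) (c : γ)
    (h : (L.map f).Nodup) : ∃ ρ : β → γ, ∀ a ∈ L, ρ (f a) = g a := by
  classical
  refine ⟨fun b => if hb : ∃ a ∈ L, f a = b then g hb.choose else c, ?_⟩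
  intro a ha
  have hb : ∃ a' ∈ L, f a' = f a := ⟨a, ha, rfl⟩
  simp only [dif_pos hb]
  rw [List.inj_on_of_nodup_map h hb.choose_spec.1 ha hb.choose_spec.2]

/-- `g` is represented by a tree diagram whose permutation is of the kind `r`. -/
def HasDiagram (r : List BinWord → List BinWord → Prop) (g : CantorPerm) : Prop :=
  ∃ D : TreeDiagram, r (D.branches.map Prod.snd) D.ran.branches ∧ D.Represents g

section Closure

variable {r : List BinWord → List BinWord → Prop}

theorem HasDiagram.one (hr : IsListRel r) : HasDiagram r 1 := by
  refine ⟨⟨.leaf, .leaf, [([], [])], rfl, .refl _⟩, hr.refl _, ?_⟩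
  intro p hp x
  rw [List.mem_singleton] at hp
  subst hp
  rfl

theorem HasDiagram.inv (hr : IsListRel r) {g : CantorPerm} (hg : HasDiagram r g) :
    HasDiagram r g⁻¹ := by
  obtain ⟨D, hD, hDg⟩ := hg
  obtain ⟨ρ, hρ⟩ := exists_lookup D.branches Prod.snd Prod.fst [] D.nodup_snd
  have h1 : (D.branches.map Prod.snd).map ρ = D.dom.branches := by
    rw [List.map_map, ← D.fst_eq]
    exact List.map_congr_left hρ
  have h2 : r ((D.ran.branches.map fun v => (v, ρ v)).map Prod.snd) D.dom.branches := by
    rw [List.map_map, ← h1]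
    exact hr.map ρ (hr.symm hD)
  refine ⟨⟨D.ran, D.dom, D.ran.branches.map fun v => (v, ρ v), ?_, hr.perm h2⟩, h2, ?_⟩
  · rw [List.map_map]; exact List.map_id _
  · intro p hp x
    obtain ⟨v, hv, rfl⟩ := List.mem_map.1 hp
    obtain ⟨q, hq, rfl⟩ := List.mem_map.1 (D.snd_perm.mem_iff.2 hv)
    rw [MulOpposite.unop_inv, Equiv.Perm.inv_eq_iff_eq, hρ q hq]
    exact (hDg q hq x).symm

theorem TreeDiagram.exists_refinement (hr : IsListRel r) {D : TreeDiagram} {g : CantorPerm}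
    (hD : r (D.branches.map Prod.snd) D.ran.branches) (hDg : D.Represents g)
    (θ : BinWord × BinWord → FullTree) {φ ψ : BinWord → FullTree}
    (hφ : ∀ p ∈ D.branches, φ p.1 = θ p) (hψ : ∀ p ∈ D.branches, ψ p.2 = θ p) :
    ∃ D' : TreeDiagram, D'.dom = D.dom.graft φ ∧ D'.ran = D.ran.graft ψ ∧
      r (D'.branches.map Prod.snd) D'.ran.branches ∧ D'.Represents g := by
  let B := D.branches.flatMap fun p => (θ p).branches.map fun s => (p.1 ++ s, p.2 ++ s)
  have h1 : B.map Prod.fst = (D.dom.graft φ).branches := by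
    rw [FullTree.branches_graft, ← D.fst_eq, List.flatMap_map, List.map_flatMap]
    refine List.flatMap_congr fun p hp => ?_
    rw [hφ p hp, List.map_map]; rfl
  have h2 : r (B.map Prod.snd) (D.ran.graft ψ).branches := by
    have h3 : B.map Prod.snd =
        (D.branches.map Prod.snd).flatMap fun v => (ψ v).branches.map (v ++ ·) := by
      rw [List.flatMap_map, List.map_flatMap]
      refine List.flatMap_congr fun p hp => ?_
      rw [hψ p hp, List.map_map]; rfl
    rw [h3, FullTree.branches_graft]
    exact hr.flatMap _ hD
  refine ⟨⟨_, _, B, h1, hr.perm h2⟩, rfl, rfl, h2, ?_⟩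
  intro q hq x
  obtain ⟨p, hp, hq⟩ := List.mem_flatMap.1 hq
  obtain ⟨s, -, rfl⟩ := List.mem_map.1 hq
  simp only [Stream'.append_append_stream]
  exact hDg p hp _

theorem HasDiagram.mul (hr : IsListRel r) {f g : CantorPerm} (hf : HasDiagram r f)
    (hg : HasDiagram r g) : HasDiagram r (f * g) := by
  obtain ⟨D, hD, hDf⟩ := hf
  obtain ⟨E, hE, hEg⟩ := hg
  obtain ⟨φ, ψ, hφψ⟩ := FullTree.exists_common_graft D.ran E.dom
  obtain ⟨φ', hφ'⟩ := exists_lookup D.branches Prod.fst (fun p => φ p.2) .leaf D.nodup_fst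
  obtain ⟨ψ', hψ'⟩ := exists_lookup E.branches Prod.snd (fun p => ψ p.1) .leaf E.nodup_snd
  obtain ⟨D', -, hD'r, hD', hD'f⟩ := TreeDiagram.exists_refinement hr hD hDf (fun p => φ p.2) hφ'
    (fun _ _ => rfl)
  obtain ⟨E', hE'd, -, hE', hE'g⟩ := TreeDiagram.exists_refinement hr hE hEg (fun p => ψ p.1)
    (fun _ _ => rfl) hψ'
  have hDE : D'.ran = E'.dom := by rw [hD'r, hE'd, hφψ]
  obtain ⟨τ, hτ⟩ := exists_lookup E'.branches Prod.fst Prod.snd [] E'.nodup_fst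
  have h1 : E'.dom.branches.map τ = E'.branches.map Prod.snd := by
    rw [← E'.fst_eq, List.map_map]
    exact List.map_congr_left hτ
  have h2 : r ((D'.branches.map fun p => (p.1, τ p.2)).map Prod.snd) E'.ran.branches := by
    have h3 := hr.map τ hD'
    rw [hDE, h1, List.map_map] at h3
    rw [List.map_map]
    exact hr.trans h3 hE'
  refine ⟨⟨D'.dom, E'.ran, D'.branches.map fun p => (p.1, τ p.2), ?_, hr.perm h2⟩, h2, ?_⟩
  · rw [List.map_map]; exact D'.fst_eq
  · intro q hq x
    obtain ⟨p, hp, rfl⟩ := List.mem_map.1 hq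
    have h4 := D'.snd_mem hp
    rw [hDE, ← E'.fst_eq] at h4
    obtain ⟨e, he, hep⟩ := List.mem_map.1 h4
    rw [mul_apply, hD'f p hp x, ← hep, hE'g e he x, hτ e he]

end Closure

/-- Thompson's group `V`: all elements represented by tree diagrams. -/
def groupV : Subgroup CantorPerm where
  carrier := {g | ∃ D : TreeDiagram, D.Represents g}
  one_mem' := (HasDiagram.one isListRel_perm).imp fun _ h => h.2
  mul_mem' := by
    rintro f g ⟨D, hD⟩ ⟨E, hE⟩
    exact (HasDiagram.mul isListRel_perm ⟨D, D.snd_perm, hD⟩ ⟨E, E.snd_perm, hE⟩).imp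
      fun _ h => h.2
  inv_mem' := by
    rintro f ⟨D, hD⟩
    exact (HasDiagram.inv isListRel_perm ⟨D, D.snd_perm, hD⟩).imp fun _ h => h.2

/-- Thompson's group `T`: all elements represented by tree diagrams with a cyclic permutation. -/
def groupT : Subgroup CantorPerm where
  carrier := {g | ∃ D : TreeDiagram, D.IsCyclic ∧ D.Represents g}
  one_mem' := HasDiagram.one isListRel_isRotated
  mul_mem' := HasDiagram.mul isListRel_isRotated
  inv_mem' := HasDiagram.inv isListRel_isRotated

/-- Thompson's group `F`: all elements represented by tree diagrams with the identity
permutation. -/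
def groupF : Subgroup CantorPerm where
  carrier := {g | ∃ D : TreeDiagram, D.IsIdentity ∧ D.Represents g}
  one_mem' := HasDiagram.one isListRel_eq
  mul_mem' := HasDiagram.mul isListRel_eq
  inv_mem' := HasDiagram.inv isListRel_eq

/-- `𝒩(g)`: the number of leaves in each of the trees of the reduced tree diagram of `g ∈ V`. (The
reduced tree diagram is unique, so that the infimum is over a set with one element.) -/
noncomputable def leafNumber (g : CantorPerm) : ℕ :=
  sInf {n | ∃ D : TreeDiagram, D.IsReduced ∧ D.Represents g ∧ D.numLeaves = n}

/-! ### The standard generators -/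

/-- The tree diagram `00 → 0`, `01 → 10`, `1 → 11`. -/
def x₀Diagram : TreeDiagram where
  dom := .caret (.caret .leaf .leaf) .leaf
  ran := .caret .leaf (.caret .leaf .leaf)
  branches := [([false, false], [false]), ([false, true], [true, false]), ([true], [true, true])]
  fst_eq := rfl
  snd_perm := .refl _

/-- The tree diagram `0 → 0`, `100 → 10`, `101 → 110`, `11 → 111`. -/
def x₁Diagram : TreeDiagram where
  dom := .caret .leaf (.caret (.caret .leaf .leaf) .leaf)
  ran := .caret .leaf (.caret .leaf (.caret .leaf .leaf))
  branches := [([false], [false]), ([true, false, false], [true, false]),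
    ([true, false, true], [true, true, false]), ([true, true], [true, true, true])]
  fst_eq := rfl
  snd_perm := .refl _

/-- The tree diagram `0 → 10`, `10 → 11`, `11 → 0`. -/
def c₁Diagram : TreeDiagram where
  dom := .caret .leaf (.caret .leaf .leaf)
  ran := .caret .leaf (.caret .leaf .leaf)
  branches := [([false], [true, false]), ([true, false], [true, true]), ([true, true], [false])]
  fst_eq := rfl
  snd_perm := by decide

/-- The tree diagram `0 → 10`, `10 → 0`, `11 → 11`. -/
def π₀Diagram : TreeDiagram where
  dom := .caret .leaf (.caret .leaf .leaf)
  ran := .caret .leaf (.caret .leaf .leaf)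
  branches := [([false], [true, false]), ([true, false], [false]), ([true, true], [true, true])]
  fst_eq := rfl
  snd_perm := by decide

/-- The generator `x₀`. -/
noncomputable def x₀ : CantorPerm := x₀Diagram.toPerm

/-- The generator `x₁`. -/
noncomputable def x₁ : CantorPerm := x₁Diagram.toPerm

/-- The generator `c₁`. -/
noncomputable def c₁ : CantorPerm := c₁Diagram.toPerm

/-- The generator `π₀`. -/
noncomputable def π₀ : CantorPerm := π₀Diagram.toPerm

/-- The names of the three Thompson groups. -/
inductive Kind : Type
  | F
  | T
  | V

/-- The Thompson group of the given name. -/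
def Kind.group : Kind → Subgroup CantorPerm
  | .F => groupF
  | .T => groupT
  | .V => groupV

/-- The standard generating set of the Thompson group of the given name. -/
def Kind.generators : Kind → Set CantorPerm
  | .F => {x₀, x₁}
  | .T => {x₀, x₁, c₁}
  | .V => {x₀, x₁, c₁, π₀}

theorem Kind.generators_subset (𝒢 : Kind) : 𝒢.generators ⊆ 𝒢.group := by
  have h0 : x₀ ∈ groupF := ⟨x₀Diagram, rfl, x₀Diagram.represents_toPerm⟩
  have h1 : x₁ ∈ groupF := ⟨x₁Diagram, rfl, x₁Diagram.represents_toPerm⟩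
  have h2 : c₁ ∈ groupT := ⟨c₁Diagram, ⟨2, rfl⟩, c₁Diagram.represents_toPerm⟩
  have h3 : π₀ ∈ groupV := ⟨π₀Diagram, π₀Diagram.represents_toPerm⟩
  have hFT : groupF ≤ groupT := fun g ⟨D, hD, hg⟩ =>
    ⟨D, ⟨0, by rw [List.rotate_zero]; exact hD⟩, hg⟩
  have hTV : groupT ≤ groupV := fun g ⟨D, _, hg⟩ => ⟨D, hg⟩
  cases 𝒢 with
  | F => rintro g (rfl | rfl) <;> assumption
  | T => rintro g (rfl | rfl | rfl) <;> first | assumption | exact hFT ‹_›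
  | V => rintro g (rfl | rfl | rfl | rfl) <;> first | assumption | exact hTV ‹_› | exact hTV (hFT ‹_›)

/-! ### Words and word length -/

section Words

variable {G : Type*} [Group G]

/-- `w` is a word in the alphabet `X`: each letter of `w` is an element of `X` or the inverse of an
element of `X`. Its value in `G` is `w.prod`, its length is `w.length`. -/
def IsWord (X : Set G) (w : List G) : Prop := ∀ a ∈ w, a ∈ X ∨ a⁻¹ ∈ X

/-- The word length `|g|_X` of `g` with respect to the generating set `X`. -/
noncomputable def wordLength (X : Set G) (g : G) : ℕ :=
  sInf {n | ∃ w : List G, IsWord X w ∧ w.prod = g ∧ w.length = n}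

end Words

end Thompson

/-! Write `n` for the length of `g`, and `sub v f` for the copy of `f` on the cone of `v`. The
target is `sub p x₀` with `p = 0^(20n-1)`. Two facts drive the proof. First, an element of length
`m` acts on every cone of depth at least `m + 2` as a replacement of prefixes and changes the depth
by at most `m` (`exists_lin`). Since `x₀` is not a replacement of prefixes, `sub v x₀` followed by a
map that is one on the cone of `v` has length at least `v.length - 1`. Secondly, if `g` takes the
cone of `p` to that of `v`, then `g * sub v x₀ = sub p x₀ * g` (`conj_sub`).

So it suffices to go from `g` to `g * sub v x₀ = sub p x₀ * g`: a word for `g⁻¹` of length `n` then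
leads to `sub p x₀`, and it stays far from the identity because `sub p x₀` is much longer than the
elements `g * w'` that occur.

For the first part, `g * x₀^j` and `g * x₀^(-j)` cannot both come close to the identity, so one of
these rays from `g` is safe (`exists_stretch_avoids`). For the corresponding letter `b`, the element
`q = sub (b^(K+1)) x₀` is a power of `x₀^±1`, one letter `x₁^±1`, and a power back; following the
ray out and another ray in joins `g` to `g * q` (`joined_sub_replicate`). If `v` is not itself a
power of `b`, take `K` large. A word for `sub v x₀` leads from `g * q` to `g * q * sub v x₀`, safely
because `q` acts on a cone too deep for this word to undo. The two copies commute, and `q` is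
removed along rays from `g * sub v x₀` and `g * sub v x₀ * q`, whose safety comes from comparing
expansion at the end point `bbb…` (`Germ`).

Word length is an infimum that takes the value 0 off the subgroup generated by the alphabet, so it
must also be shown that `g` lies in that subgroup. -/

namespace Thompson

/-! ### Linear action on cones -/

/-- The map `f` takes `uz` to `vz` for every infinite word `z`. -/
def Lin (f : CantorPerm) (u v : BinWord) : Prop :=
  ∀ z : Cantor, f.unop (u ++ₛ z) = v ++ₛ z

theorem Lin.one (u : BinWord) : Lin 1 u u := fun _ => rfl

theorem Lin.mul {f g : CantorPerm} {u v w : BinWord} (hf : Lin f u v) (hg : Lin g v w) :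
    Lin (f * g) u w := fun z => by rw [mul_apply, hf, hg]

theorem Lin.inv {f : CantorPerm} {u v : BinWord} (h : Lin f u v) : Lin f⁻¹ v u := fun z => by
  rw [MulOpposite.unop_inv, Equiv.Perm.inv_eq_iff_eq]
  exact (h z).symm

theorem Lin.append {f : CantorPerm} {u v : BinWord} (h : Lin f u v) (t : BinWord) :
    Lin f (u ++ t) (v ++ t) := fun z => by
  rw [Stream'.append_append_stream, Stream'.append_append_stream, h]

theorem length_eq_of_append_eq {a b : BinWord}
    (h : ∀ z : Cantor, a ++ₛ z = b ++ₛ z) : a.length = b.length := by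
  have key : ∀ (c : Bool) (t : BinWord), ¬ ∀ z : Cantor, z = (c :: t) ++ₛ z := by
    intro c t h
    have := congrArg Stream'.head (h (Stream'.const (!c)))
    rw [Stream'.cons_append_stream, Stream'.head_cons] at this
    change (!c) = c at this
    cases c <;> simp at this
  induction a generalizing b with
  | nil =>
    cases b with
    | nil => rfl
    | cons c t => exact absurd h (key c t)
  | cons c a ih =>
    cases b with
    | nil => exact absurd (fun z => (h z).symm) (key c a)
    | cons d b =>
      rw [List.length_cons, List.length_cons, ih fun z => ?_]
      have := h z
      rw [Stream'.cons_append_stream, Stream'.cons_append_stream] at this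
      exact (Stream'.cons_injective2 this).2

theorem exists_append_of_append_eq {p u : BinWord} {y z : Cantor} (h : u ++ₛ z = p ++ₛ y)
    (hl : p.length ≤ u.length) : ∃ t, u = p ++ t ∧ y = t ++ₛ z := by
  induction p generalizing u with
  | nil => exact ⟨u, rfl, h.symm⟩
  | cons c p ih =>
    cases u with
    | nil => simp at hl
    | cons d u =>
      rw [Stream'.cons_append_stream, Stream'.cons_append_stream] at h
      obtain ⟨h1, h2⟩ := Stream'.cons_injective2 h
      obtain ⟨t, rfl, ht⟩ := ih h2 (by simpa using hl)
      exact ⟨t, by rw [h1]; rfl, ht⟩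

theorem append_ne_append {u v : BinWord} (h1 : ¬ u <+: v) (h2 : ¬ v <+: u) (y z : Cantor) :
    u ++ₛ y ≠ v ++ₛ z := by
  intro h
  rcases le_total v.length u.length with hl | hl
  · obtain ⟨t, rfl, -⟩ := exists_append_of_append_eq h hl
    exact h2 (List.prefix_append _ _)
  · obtain ⟨t, rfl, -⟩ := exists_append_of_append_eq h.symm hl
    exact h1 (List.prefix_append _ _)

/-! ### Action of the generators -/

theorem x₀_lin : Lin x₀ [false, false] [false] ∧ Lin x₀ [false, true] [true, false] ∧
    Lin x₀ [true] [true, true] := by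
  have h := x₀Diagram.represents_toPerm
  exact ⟨h ([false, false], [false]) (by simp [x₀Diagram]),
    h ([false, true], [true, false]) (by simp [x₀Diagram]),
    h ([true], [true, true]) (by simp [x₀Diagram])⟩

theorem x₁_lin : Lin x₁ [false] [false] ∧ Lin x₁ [true, false, false] [true, false] ∧
    Lin x₁ [true, false, true] [true, true, false] ∧ Lin x₁ [true, true] [true, true, true] := by
  have h := x₁Diagram.represents_toPerm
  exact ⟨h ([false], [false]) (by simp [x₁Diagram]),
    h ([true, false, false], [true, false]) (by simp [x₁Diagram]),
    h ([true, false, true], [true, true, false]) (by simp [x₁Diagram]),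
    h ([true, true], [true, true, true]) (by simp [x₁Diagram])⟩

theorem c₁_lin : Lin c₁ [false] [true, false] ∧ Lin c₁ [true, false] [true, true] ∧
    Lin c₁ [true, true] [false] := by
  have h := c₁Diagram.represents_toPerm
  exact ⟨h ([false], [true, false]) (by simp [c₁Diagram]),
    h ([true, false], [true, true]) (by simp [c₁Diagram]),
    h ([true, true], [false]) (by simp [c₁Diagram])⟩

theorem π₀_lin : Lin π₀ [false] [true, false] ∧ Lin π₀ [true, false] [false] ∧
    Lin π₀ [true, true] [true, true] := by
  have h := π₀Diagram.represents_toPerm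
  exact ⟨h ([false], [true, false]) (by simp [π₀Diagram]),
    h ([true, false], [false]) (by simp [π₀Diagram]),
    h ([true, true], [true, true]) (by simp [π₀Diagram])⟩

/-! ### Copies of a map on a cone -/

/-- The copy of `f` on the cone of the letter `b`, extended by the identity. -/
def copy (b : Bool) : CantorPerm →* CantorPerm where
  toFun f := MulOpposite.op
    { toFun := fun x => if x.head = b then Stream'.cons b (f.unop x.tail) else x
      invFun := fun x => if x.head = b then Stream'.cons b (f.unop.symm x.tail) else x
      left_inv := fun x => by
        by_cases h : x.head = b
        · simp only [h, if_true, Stream'.head_cons, Stream'.tail_cons, Equiv.symm_apply_apply]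
          rw [← h]; exact Stream'.eta x
        · simp only [h, if_false]
      right_inv := fun x => by
        by_cases h : x.head = b
        · simp only [h, if_true, Stream'.head_cons, Stream'.tail_cons, Equiv.apply_symm_apply]
          rw [← h]; exact Stream'.eta x
        · simp only [h, if_false] }
  map_one' := by
    apply MulOpposite.unop_injective
    ext1 x
    change (if x.head = b then Stream'.cons b x.tail else x) = x
    split_ifs with h
    · rw [← h]; exact Stream'.eta x
    · rfl
  map_mul' f g := by
    apply MulOpposite.unop_injective
    ext1 x
    rw [mul_apply]
    change (if x.head = b then Stream'.cons b (g.unop (f.unop x.tail)) else x) =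
      (fun x : Cantor => if x.head = b then Stream'.cons b (g.unop x.tail) else x)
        (if x.head = b then Stream'.cons b (f.unop x.tail) else x)
    by_cases h : x.head = b
    · simp only [h, if_true, Stream'.head_cons, Stream'.tail_cons]
    · simp only [h, if_false]

theorem copy_cons (b : Bool) (f : CantorPerm) (x : Cantor) :
    (copy b f).unop (Stream'.cons b x) = Stream'.cons b (f.unop x) := by
  change (if (Stream'.cons b x).head = b then Stream'.cons b (f.unop (Stream'.cons b x).tail)
    else _) = _
  rw [if_pos (Stream'.head_cons _ _), Stream'.tail_cons]

theorem copy_cons_ne {b c : Bool} (h : c ≠ b) (f : CantorPerm) (x : Cantor) :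
    (copy b f).unop (Stream'.cons c x) = Stream'.cons c x := by
  change (if (Stream'.cons c x).head = b then _ else _) = _
  rw [if_neg (by rwa [Stream'.head_cons])]

/-- The copy of `f` on the cone of the word `v`, extended by the identity. -/
def sub : BinWord → CantorPerm → CantorPerm
  | [], f => f
  | b :: v, f => copy b (sub v f)

theorem sub_append_stream (v : BinWord) (f : CantorPerm) (z : Cantor) :
    (sub v f).unop (v ++ₛ z) = v ++ₛ f.unop z := by
  induction v with
  | nil => rfl
  | cons b v ih => rw [sub, Stream'.cons_append_stream, copy_cons, ih, Stream'.cons_append_stream]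

theorem sub_apply_of_forall_ne {v : BinWord} {x : Cantor} (f : CantorPerm)
    (h : ∀ z : Cantor, x ≠ v ++ₛ z) : (sub v f).unop x = x := by
  induction v generalizing x with
  | nil => exact absurd rfl (h x)
  | cons b v ih =>
    rw [← Stream'.eta x] at h ⊢
    rw [sub]
    by_cases hb : x.head = b
    · rw [hb] at h ⊢
      rw [copy_cons, ih]
      intro z hz
      exact h z (by rw [hz, Stream'.cons_append_stream])
    · exact copy_cons_ne hb _ _

theorem Lin.sub {f : CantorPerm} {u w : BinWord} (h : Lin f u w) (v : BinWord) :
    Lin (sub v f) (v ++ u) (v ++ w) := fun z => by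
  rw [Stream'.append_append_stream, sub_append_stream, h, Stream'.append_append_stream]

theorem sub_lin_self {u v : BinWord} (f : CantorPerm) (h1 : ¬ u <+: v) (h2 : ¬ v <+: u) :
    Lin (sub v f) u u := fun z => sub_apply_of_forall_ne f fun y => append_ne_append h1 h2 z y

/-- Conjugation transports a map supported on one cone to the other, because `g` identifies the two
cones by replacing prefixes. Commutation of copies on disjoint cones is the special case where `g`
fixes the cone pointwise. -/
theorem conj_sub {g : CantorPerm} {p v : BinWord} (h : Lin g p v) (f : CantorPerm) :
    g * sub v f = sub p f * g := by
  apply MulOpposite.unop_injective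
  ext1 x
  rw [mul_apply, mul_apply]
  by_cases hx : ∃ z, x = p ++ₛ z
  · obtain ⟨z, rfl⟩ := hx
    rw [h, sub_append_stream, sub_append_stream, h]
  · rw [sub_apply_of_forall_ne f fun z hz => hx ⟨z, hz⟩, sub_apply_of_forall_ne]
    intro z hz
    rw [← h z] at hz
    exact hx ⟨z, g.unop.injective hz⟩

theorem sub_comm {u v : BinWord} (f g : CantorPerm) (h1 : ¬ u <+: v) (h2 : ¬ v <+: u) :
    sub u f * sub v g = sub v g * sub u f :=
  conj_sub (sub_lin_self f h2 h1) g

theorem sub_true_x₀ : sub [true] x₀ = x₁ := by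
  apply TreeDiagram.Represents.eq_toPerm
  intro p hp
  simp only [x₁Diagram, List.mem_cons, List.not_mem_nil, or_false] at hp
  rcases hp with rfl | rfl | rfl | rfl
  · exact sub_lin_self x₀ (by decide) (by decide)
  · exact x₀_lin.1.sub [true]
  · exact x₀_lin.2.1.sub [true]
  · exact x₀_lin.2.2.sub [true]

theorem sub_false_x₀ : sub [false] x₀ = x₀ ^ 2 * x₁⁻¹ * x₀⁻¹ := by
  have h : ∀ (f g : CantorPerm) (T : FullTree) (l : List (BinWord × BinWord)),
      l.map Prod.fst = T.branches → (∀ p ∈ l, Lin f p.1 p.2) → (∀ p ∈ l, Lin g p.1 p.2) →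
      f = g := by
    intro f g T l hl hf hg
    apply MulOpposite.unop_injective
    ext1 x
    obtain ⟨u, hu, y, rfl⟩ := T.exists_branch x
    rw [← hl, List.mem_map] at hu
    obtain ⟨p, hp, rfl⟩ := hu
    rw [hf p hp, hg p hp]
  obtain ⟨a1, a2, a3⟩ := x₀_lin
  obtain ⟨b1, b2, b3, b4⟩ := x₁_lin
  refine h _ _ (.caret (.caret (.caret .leaf .leaf) .leaf) .leaf)
    [([false, false, false], [false, false]), ([false, false, true], [false, true, false]),
      ([false, true], [false, true, true]), ([true], [true])] rfl ?_ ?_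
  · simp only [List.mem_cons, List.not_mem_nil, or_false]
    rintro p (rfl | rfl | rfl | rfl)
    · exact a1.sub [false]
    · exact a2.sub [false]
    · exact a3.sub [false]
    · exact sub_lin_self x₀ (by decide) (by decide)
  · rw [pow_two]
    simp only [List.mem_cons, List.not_mem_nil, or_false]
    rintro p (rfl | rfl | rfl | rfl)
    · exact ((((a1.append [false]).mul a1).mul b1.inv).mul a1.inv)
    · exact ((((a1.append [true]).mul a2).mul b2.inv).mul (a2.inv.append [false]))
    · exact (((a2.mul (a3.append [false])).mul b3.inv).mul (a2.inv.append [true]))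
    · exact (((a3.mul (a3.append [true])).mul b4.inv).mul a3.inv)

/-- Since `x₀` takes `0^(k+2)` to `0^(k+1)`, each conjugation by it deepens the cone by one letter.
This identifies the end point of the path in the main theorem. -/
theorem sub_replicate_false (k : ℕ) :
    sub (List.replicate (k + 1) false) x₀ = x₀ ^ (k + 2) * x₁⁻¹ * x₀⁻¹ ^ (k + 1) := by
  induction k with
  | zero => exact sub_false_x₀.trans (by simp)
  | succ k ih =>
    have h := conj_sub (x₀_lin.1.append (List.replicate k false)) x₀
    change x₀ * sub (List.replicate (k + 1) false) x₀ = sub (List.replicate (k + 2) false) x₀ * _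
      at h
    rw [eq_comm, ← eq_mul_inv_iff_mul_eq, ih] at h
    rw [h, pow_succ' _ (k + 2), pow_succ x₀⁻¹ (k + 1)]
    simp only [mul_assoc]

theorem sub_replicate_true (k : ℕ) :
    sub (List.replicate (k + 1) true) x₀ = x₀⁻¹ ^ k * x₁ * x₀ ^ k := by
  induction k with
  | zero => simpa using sub_true_x₀
  | succ k ih =>
    have h := conj_sub (x₀_lin.2.2.append (List.replicate k true)) x₀
    change x₀ * sub (List.replicate (k + 2) true) x₀ = sub (List.replicate (k + 1) true) x₀ * _
      at h
    rw [← eq_inv_mul_iff_mul_eq, ih] at h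
    rw [h, pow_succ' _ k, pow_succ x₀ k]
    simp only [mul_assoc]

/-- `x₀` shortens prefixes on the cone of `00` and lengthens them on that of `1`, so no single pair
of prefixes can account for both. -/
theorem x₀_apply_not_lin {a b : BinWord} : ¬ ∀ z : Cantor, a ++ₛ x₀.unop z = b ++ₛ z := by
  intro h
  have h1 : (a ++ [false]).length = (b ++ [false, false]).length :=
    length_eq_of_append_eq fun z => by
      rw [Stream'.append_append_stream, Stream'.append_append_stream, ← h, x₀_lin.1]
  have h2 : (a ++ [true, true]).length = (b ++ [true]).length :=
    length_eq_of_append_eq fun z => by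
      rw [Stream'.append_append_stream, Stream'.append_append_stream, ← h, x₀_lin.2.2]
  simp at h1 h2
  omega

/-! ### Words -/

section Words

variable {G : Type*} [Group G] {X : Set G}

theorem IsWord.append {v w : List G} (hv : IsWord X v) (hw : IsWord X w) : IsWord X (v ++ w) :=
  fun a ha => (List.mem_append.1 ha).elim (hv a) (hw a)

theorem IsWord.inv {w : List G} (hw : IsWord X w) : IsWord X (w.map (·⁻¹)).reverse := by
  intro a ha
  rw [List.mem_reverse, List.mem_map] at ha
  obtain ⟨b, hb, rfl⟩ := ha
  rw [inv_inv]
  exact (hw b hb).symm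

theorem IsWord.mono {Y : Set G} (h : X ⊆ Y) {w : List G} (hw : IsWord X w) : IsWord Y w :=
  fun a ha => (hw a ha).imp (@h _) (@h _)

theorem IsWord.prod_mem {w : List G} (hw : IsWord X w) : w.prod ∈ Subgroup.closure X :=
  list_prod_mem fun a ha => (hw a ha).elim (fun h => Subgroup.subset_closure h)
    fun h => (Subgroup.inv_mem_iff _).1 (Subgroup.subset_closure h)

theorem wordLength_prod_le {w : List G} (hw : IsWord X w) : wordLength X w.prod ≤ w.length :=
  Nat.sInf_le ⟨w, hw, rfl, rfl⟩

theorem exists_word_length_eq {g : G} (hg : g ∈ Subgroup.closure X) :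
    ∃ w, IsWord X w ∧ w.prod = g ∧ w.length = wordLength X g := by
  refine Nat.sInf_mem (s := {n | ∃ w : List G, IsWord X w ∧ w.prod = g ∧ w.length = n}) ?_
  rw [← Subgroup.mem_toSubmonoid, Subgroup.closure_toSubmonoid] at hg
  obtain ⟨w, hw, rfl⟩ := Submonoid.exists_list_of_mem_closure hg
  exact ⟨_, w, hw, rfl, rfl⟩

theorem wordLength_mul_le {f g : G} (hf : f ∈ Subgroup.closure X) (hg : g ∈ Subgroup.closure X) :
    wordLength X (f * g) ≤ wordLength X f + wordLength X g := by
  obtain ⟨v, hv, rfl, hv'⟩ := exists_word_length_eq hf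
  obtain ⟨w, hw, rfl, hw'⟩ := exists_word_length_eq hg
  rw [← hv', ← hw', ← List.prod_append, ← List.length_append]
  exact wordLength_prod_le (hv.append hw)

theorem wordLength_inv_le {g : G} (hg : g ∈ Subgroup.closure X) :
    wordLength X g⁻¹ ≤ wordLength X g := by
  obtain ⟨w, hw, rfl, hw'⟩ := exists_word_length_eq hg
  rw [← hw', List.prod_inv_reverse]
  exact (wordLength_prod_le hw.inv).trans (by simp)

theorem wordLength_pow_le {g : G} (hg : g ∈ X ∨ g⁻¹ ∈ X) (n : ℕ) : wordLength X (g ^ n) ≤ n := by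
  rw [← List.prod_replicate]
  exact (wordLength_prod_le fun a ha => by rwa [List.eq_of_mem_replicate ha]).trans (by simp)

end Words

/-! ### Normalizing cones by words in the generators of `F` -/

/-- Induction on the last letter: a word that normalizes `v` takes `v ++ [b]` to a normal form
followed by `b`, and at most two further letters restore one of the normal forms `0`, `1`, `10`. -/
theorem exists_word_lin (v : BinWord) (hv : v ≠ []) :
    ∃ (w : List CantorPerm) (t : BinWord), IsWord {x₀, x₁} w ∧ w.length ≤ 2 * v.length ∧
      Lin w.prod v t ∧ (t = [false] ∨ t = [true] ∨ t = [true, false]) := by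
  induction v using List.reverseRecOn with
  | nil => exact absurd rfl hv
  | append_singleton v b ih =>
    have nil : ∀ t : BinWord, ∃ w' : List CantorPerm, IsWord {x₀, x₁} w' ∧ w'.length ≤ 2 ∧
        Lin w'.prod t t := fun t => ⟨[], by simp [IsWord], by simp, Lin.one t⟩
    have single : ∀ (f : CantorPerm) {t t' : BinWord}, (f ∈ ({x₀, x₁} : Set CantorPerm) ∨
        f⁻¹ ∈ ({x₀, x₁} : Set CantorPerm)) → Lin f t t' →
        ∃ w' : List CantorPerm, IsWord {x₀, x₁} w' ∧ w'.length ≤ 2 ∧ Lin w'.prod t t' :=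
      fun f t t' h h' => ⟨[f], by simpa [IsWord] using h, by simp, by simpa using h'⟩
    suffices H : ∃ (w : List CantorPerm) (t : BinWord), IsWord {x₀, x₁} w ∧
        w.length ≤ 2 * v.length ∧ Lin w.prod (v ++ [b]) t ∧ ∃ t', (t' = [false] ∨ t' = [true] ∨
          t' = [true, false]) ∧
          ∃ w' : List CantorPerm, IsWord {x₀, x₁} w' ∧ w'.length ≤ 2 ∧ Lin w'.prod t t' by
      obtain ⟨w, t, hw, hl, ht, t', ht', w', hw', hl', hlin⟩ := H
      refine ⟨w ++ w', t', hw.append hw', ?_, ?_, ht'⟩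
      · simp only [List.length_append, List.length_singleton]; omega
      · rw [List.prod_append]; exact ht.mul hlin
    by_cases h : v = []
    · subst h
      refine ⟨[], [b], by simp [IsWord], by simp, Lin.one _, [b], ?_, nil _⟩
      cases b <;> simp
    · obtain ⟨w, t, hw, hl, ht, ht'⟩ := ih h
      refine ⟨w, t ++ [b], hw, hl, ht.append [b], ?_⟩
      rcases ht' with rfl | rfl | rfl <;> cases b
      · exact ⟨[false], by simp, single x₀ (by simp) x₀_lin.1⟩
      · exact ⟨[true, false], by simp, single x₀ (by simp) x₀_lin.2.1⟩
      · exact ⟨[true, false], by simp, nil _⟩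
      · exact ⟨[true], by simp, single x₀⁻¹ (by simp) x₀_lin.2.2.inv⟩
      · exact ⟨[true, false], by simp, single x₁ (by simp) x₁_lin.2.1⟩
      -- The only case that costs two letters: `101 → 110 → 10`.
      · refine ⟨[true, false], by simp, [x₁, x₀⁻¹], by simp [IsWord], by simp, ?_⟩
        simpa using x₁_lin.2.2.1.mul (x₀_lin.2.2.inv.append [false])

/-! ### Lists of cones -/

section Lists

variable {f g : CantorPerm} {l l' l'' : List BinWord}

theorem forall₂_lin_mul (hf : List.Forall₂ (Lin f) l l') (hg : List.Forall₂ (Lin g) l' l'') :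
    List.Forall₂ (Lin (f * g)) l l'' := by
  induction hf generalizing l'' with
  | nil => cases hg; exact .nil
  | cons h _ ih =>
    cases hg with
    | cons h' ht => exact .cons (h.mul h') (ih ht)

theorem forall₂_lin_inv (hf : List.Forall₂ (Lin f) l l') : List.Forall₂ (Lin f⁻¹) l' l := by
  induction hf with
  | nil => exact .nil
  | cons h _ ih => exact .cons h.inv ih

theorem forall₂_lin_copy (b : Bool) (hf : List.Forall₂ (Lin f) l l') :
    List.Forall₂ (Lin (copy b f)) (l.map (List.cons b)) (l'.map (List.cons b)) := by
  rw [List.forall₂_map_left_iff, List.forall₂_map_right_iff]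
  exact hf.imp fun _ _ h => h.sub [b]

theorem forall₂_lin_append {u v : BinWord} (h : Lin f u v) (l : List BinWord) :
    List.Forall₂ (Lin f) (l.map (u ++ ·)) (l.map (v ++ ·)) := by
  rw [List.forall₂_map_left_iff, List.forall₂_map_right_iff, List.forall₂_same]
  exact fun t _ => h.append t

theorem forall₂_lin_one (l : List BinWord) : List.Forall₂ (Lin 1) l l :=
  List.forall₂_same.2 fun u _ => Lin.one u

theorem eq_of_forall₂_lin {T : FullTree} (hf : List.Forall₂ (Lin f) T.branches l)
    (hg : List.Forall₂ (Lin g) T.branches l) : f = g := by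
  have key : ∀ {l₁ l₂}, List.Forall₂ (Lin f) l₁ l₂ → List.Forall₂ (Lin g) l₁ l₂ →
      ∀ u ∈ l₁, ∀ z : Cantor, f.unop (u ++ₛ z) = g.unop (u ++ₛ z) := by
    intro l₁ l₂ h1
    induction h1 with
    | nil => simp
    | cons h _ ih =>
      rintro (_ | ⟨h', ht⟩) u hu z
      rcases List.mem_cons.1 hu with rfl | hu
      · rw [h, h']
      · exact ih ht u hu z
  apply MulOpposite.unop_injective
  ext1 x
  obtain ⟨u, hu, y, rfl⟩ := T.exists_branch x
  exact key hf hg u hu y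

theorem TreeDiagram.Represents.forall₂ {D : TreeDiagram} (h : D.Represents g) :
    List.Forall₂ (Lin g) D.dom.branches (D.branches.map Prod.snd) := by
  rw [← D.fst_eq, List.forall₂_map_left_iff, List.forall₂_map_right_iff, List.forall₂_same]
  exact h

end Lists

/-! ### Generation of `F` -/

/-- The tree all of whose carets lie on the rightmost path. -/
def vine : ℕ → FullTree
  | 0 => .leaf
  | n + 1 => .caret .leaf (vine n)

theorem branches_vine_succ (n : ℕ) :
    (vine (n + 1)).branches = [false] :: (vine n).branches.map (List.cons true) := rfl

theorem length_branches_vine (n : ℕ) : (vine n).branches.length = n + 1 := by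
  induction n with
  | zero => rfl
  | succ n ih => rw [branches_vine_succ]; simp [ih]

theorem copy_true_mem {f : CantorPerm} (hf : f ∈ Subgroup.closure ({x₀, x₁} : Set CantorPerm)) :
    copy true f ∈ Subgroup.closure ({x₀, x₁} : Set CantorPerm) := by
  have h0 : x₀ ∈ Subgroup.closure ({x₀, x₁} : Set CantorPerm) :=
    Subgroup.subset_closure (by simp)
  have h1 : x₁ ∈ Subgroup.closure ({x₀, x₁} : Set CantorPerm) :=
    Subgroup.subset_closure (by simp)
  suffices H : Subgroup.closure ({x₀, x₁} : Set CantorPerm) ≤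
      (Subgroup.closure ({x₀, x₁} : Set CantorPerm)).comap (copy true) from H hf
  rw [Subgroup.closure_le]
  have h2 : copy true x₀ = x₁ := sub_true_x₀
  rintro f (rfl | rfl)
  · change copy true x₀ ∈ Subgroup.closure ({x₀, x₁} : Set CantorPerm)
    rwa [h2]
  · change copy true x₁ ∈ Subgroup.closure ({x₀, x₁} : Set CantorPerm)
    have h3 : copy true x₁ = sub (List.replicate 2 true) x₀ := by rw [← h2]; rfl
    rw [h3, sub_replicate_true 1, pow_one, pow_one]
    exact mul_mem (mul_mem (inv_mem h0) h1) h0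

/-- `x₀` rotates a caret at the root from left to right, and copies of elements on the cone of `1`
stay in the subgroup; together these straighten any tree into a vine. An element of `F` then factors
through a vine common to both of its trees. -/
theorem exists_forall₂_vine (T : FullTree) :
    ∃ n, ∃ h ∈ Subgroup.closure ({x₀, x₁} : Set CantorPerm),
      List.Forall₂ (Lin h) T.branches (vine n).branches := by
  have key : ∀ l r : FullTree, (∃ n, ∃ h ∈ Subgroup.closure ({x₀, x₁} : Set CantorPerm),
      List.Forall₂ (Lin h) r.branches (vine n).branches) →
      ∃ n, ∃ h ∈ Subgroup.closure ({x₀, x₁} : Set CantorPerm),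
        List.Forall₂ (Lin h) (FullTree.caret l r).branches (vine n).branches := by
    intro l
    induction l with
    | leaf =>
      rintro r ⟨n, h, hh, hr⟩
      exact ⟨n + 1, copy true h, copy_true_mem hh,
        .cons (sub_lin_self (u := [false]) (v := [true]) h (by decide) (by decide))
          (forall₂_lin_copy true hr)⟩
    | caret a b iha ihb =>
      intro r hr
      -- The rotation turns `((a b) r)` into `(a (b r))`, whose left subtree is smaller.
      obtain ⟨n, h, hh, hl⟩ := iha (.caret b r) (ihb r hr)
      refine ⟨n, x₀ * h, mul_mem (Subgroup.subset_closure (by simp)) hh, forall₂_lin_mul ?_ hl⟩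
      simp only [FullTree.branches, List.map_append, List.map_map, List.append_assoc]
      exact List.rel_append (forall₂_lin_append x₀_lin.1 _)
        (List.rel_append (forall₂_lin_append x₀_lin.2.1 _) (forall₂_lin_append x₀_lin.2.2 _))
  induction T with
  | leaf => exact ⟨0, 1, one_mem _, forall₂_lin_one _⟩
  | caret l r _ ihr => exact key l r ihr

theorem groupF_le_closure : groupF ≤ Subgroup.closure ({x₀, x₁} : Set CantorPerm) := by
  rintro g ⟨D, hD, hg⟩
  obtain ⟨m, h, hh, hl⟩ := exists_forall₂_vine D.dom
  obtain ⟨n, k, hk, hl'⟩ := exists_forall₂_vine D.ran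
  have h2 := hg.forall₂
  rw [hD] at h2
  have hmn : m = n := by
    have h3 := hl.length_eq
    have h4 := hl'.length_eq
    have h5 := h2.length_eq
    rw [length_branches_vine] at h3 h4
    omega
  subst hmn
  rw [eq_of_forall₂_lin h2 (forall₂_lin_mul hl (forall₂_lin_inv hl'))]
  exact mul_mem hh (inv_mem hk)

/-! ### Generation of `T` -/

theorem exists_branches_eq_cons (T : FullTree) :
    ∃ k l, T.branches = List.replicate k false :: l := by
  induction T with
  | leaf => exact ⟨0, [], rfl⟩
  | caret l r ihl _ =>
    obtain ⟨k, l', h⟩ := ihl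
    exact ⟨k + 1, _, by rw [FullTree.branches, h]; rfl⟩

theorem replicate_append_const (b : Bool) (k : ℕ) :
    List.replicate k b ++ₛ Stream'.const b = Stream'.const b := by
  induction k with
  | zero => rfl
  | succ k ih => rw [List.replicate_succ, Stream'.cons_append_stream, ih, ← Stream'.const_eq]

theorem eq_of_isRotated_cons {α : Type*} {a : α} {l l' : List α}
    (h : (a :: l).IsRotated (a :: l')) (hn : (a :: l).Nodup) : l = l' := by
  obtain ⟨k, hk⟩ := h
  have h1 : 0 < ((a :: l).rotate k).length := by simp
  have h2 := List.getElem_rotate (a :: l) k 0 h1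
  have h3 : ((a :: l).rotate k)[0] = (a :: l)[0]'(by simp) := by simp only [hk]; rfl
  rw [h3, hn.getElem_inj_iff, Nat.zero_add] at h2
  rw [← List.rotate_mod, ← h2, List.rotate_zero] at hk
  exact (List.cons.inj hk).2

/-- The hypothesis makes `f` fix `000…`, so the first leaf goes to the first leaf, and a rotation of
a list without repetitions that keeps the head is trivial. -/
theorem mem_groupF_of_lin {f : CantorPerm} (hf : f ∈ groupT) {i j : ℕ}
    (h : Lin f (List.replicate i false) (List.replicate j false)) : f ∈ groupF := by
  obtain ⟨D, hD, hDf⟩ := hf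
  refine ⟨D, ?_, hDf⟩
  obtain ⟨a, l, hl⟩ := exists_branches_eq_cons D.dom
  obtain ⟨b, l', hl'⟩ := exists_branches_eq_cons D.ran
  have h1 := hDf.forall₂
  rw [hl, List.forall₂_cons_left_iff] at h1
  obtain ⟨v, m, hv, -, hm⟩ := h1
  have h2 : v ++ₛ Stream'.const false = List.replicate b false ++ₛ Stream'.const false := by
    have h3 := h (Stream'.const false)
    rw [replicate_append_const, replicate_append_const] at h3
    rw [← hv, replicate_append_const, replicate_append_const, h3]
  have hvm : v ∈ D.ran.branches := D.snd_perm.mem_iff.1 (by rw [hm]; simp)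
  obtain ⟨rfl, -⟩ := D.ran.branch_unique hvm (by rw [hl']; simp) h2
  have h3 := D.nodup_snd
  change List.IsRotated _ _ at hD
  change _ = _
  rw [hm] at h3 hD ⊢
  rw [hl'] at hD ⊢
  rw [eq_of_isRotated_cons hD h3]

/-- The image of the leftmost cone is carried back to the cone of `0` by a word over `x₀`, `x₁` and,
if needed, `c₁ * c₁`, which takes `10` to `0`. The product then lies in `F`. -/
theorem groupT_le_closure : groupT ≤ Subgroup.closure ({x₀, x₁, c₁} : Set CantorPerm) := by
  intro g hg
  have hsub : Subgroup.closure ({x₀, x₁} : Set CantorPerm) ≤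
      Subgroup.closure ({x₀, x₁, c₁} : Set CantorPerm) :=
    Subgroup.closure_mono (by intro a; simp only [Set.mem_insert_iff, Set.mem_singleton_iff]; tauto)
  have hT : Subgroup.closure ({x₀, x₁, c₁} : Set CantorPerm) ≤ groupT :=
    (Subgroup.closure_le _).2 (Kind.generators_subset .T)
  have hc : c₁ ∈ Subgroup.closure ({x₀, x₁, c₁} : Set CantorPerm) :=
    Subgroup.subset_closure (by simp)
  obtain ⟨D, hD, hDg⟩ := id hg
  obtain ⟨k, l, hl⟩ := exists_branches_eq_cons D.dom
  have h1 := hDg.forall₂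
  rw [hl, List.forall₂_cons_left_iff] at h1
  obtain ⟨v, -, hv, -, -⟩ := h1
  obtain ⟨w, t, hw, -, hlin, ht⟩ := exists_word_lin (v ++ [false]) (by simp)
  have hgw : Lin (g * w.prod) (List.replicate (k + 1) false) t := by
    rw [List.replicate_succ']
    exact (hv.append [false]).mul hlin
  have hwm := hsub hw.prod_mem
  suffices H : ∃ h ∈ Subgroup.closure ({x₀, x₁, c₁} : Set CantorPerm), ∃ i,
      Lin (g * h) (List.replicate i false) (List.replicate 1 false) by
    obtain ⟨h, hh, i, hi⟩ := H
    exact (Subgroup.mul_mem_cancel_right _ hh).1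
      (hsub (groupF_le_closure (mem_groupF_of_lin (mul_mem hg (hT hh)) hi)))
  rcases ht with rfl | rfl | rfl
  · exact ⟨_, hwm, _, hgw⟩
  · refine ⟨w.prod * (c₁ * c₁), mul_mem hwm (mul_mem hc hc), k + 2, ?_⟩
    rw [← mul_assoc, List.replicate_succ']
    exact (hgw.append [false]).mul (c₁_lin.2.1.mul c₁_lin.2.2)
  · refine ⟨w.prod * (c₁ * c₁), mul_mem hwm (mul_mem hc hc), k + 1, ?_⟩
    rw [← mul_assoc]
    exact hgw.mul (c₁_lin.2.1.mul c₁_lin.2.2)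

/-! ### Generation of `V` -/

theorem vine_consecutive {n : ℕ} {p l : List BinWord} {x y : BinWord}
    (h : (vine n).branches = p ++ x :: y :: l) :
    x = List.replicate p.length true ++ [false] ∧
      (y = List.replicate (p.length + 1) true ++ [false] ∨
        y = List.replicate (p.length + 1) true ∧ n = p.length + 1) := by
  induction n generalizing p l x y with
  | zero =>
    have := congrArg List.length h
    simp [vine, FullTree.branches] at this
    omega
  | succ n ih =>
    rw [branches_vine_succ] at h
    cases p with
    | nil =>
      rw [List.nil_append, List.cons.injEq] at h
      refine ⟨h.1.symm, ?_⟩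
      have h2 := h.2
      cases n with
      | zero =>
        right
        simp only [vine, FullTree.branches, List.map_cons, List.map_nil, List.cons.injEq] at h2
        exact ⟨h2.1.symm, rfl⟩
      | succ n =>
        left
        rw [branches_vine_succ, List.map_cons, List.cons.injEq] at h2
        exact h2.1.symm
    | cons a p =>
      rw [List.cons_append, List.cons.injEq] at h
      obtain ⟨p', l', h1, rfl, h2⟩ := List.map_eq_append_iff.1 h.2
      obtain ⟨x', l'', rfl, rfl, h3⟩ := List.map_eq_cons_iff.1 h2
      obtain ⟨y', l', rfl, rfl, rfl⟩ := List.map_eq_cons_iff.1 h3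
      obtain ⟨rfl, h5⟩ := ih h1
      simp only [List.length_cons, List.length_map]
      refine ⟨rfl, ?_⟩
      rcases h5 with rfl | ⟨rfl, rfl⟩
      · exact .inl rfl
      · exact .inr ⟨rfl, rfl⟩

theorem x₀_inv_pow_lin (k : ℕ) (t : BinWord) :
    Lin (x₀⁻¹ ^ k) (List.replicate k true ++ (true :: t)) (true :: t) := by
  induction k with
  | zero => exact Lin.one _
  | succ k ih =>
    have h := x₀_lin.2.2.inv.append (List.replicate k true ++ t)
    have h1 : [true] ++ (List.replicate k true ++ t) = List.replicate k true ++ (true :: t) := by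
      rw [List.append_cons, ← List.replicate_succ', List.replicate_succ]
      rfl
    have h2 : [true, true] ++ (List.replicate k true ++ t) =
        List.replicate (k + 1) true ++ (true :: t) := by
      exact congrArg (List.cons true) h1
    rw [h1, h2] at h
    rw [pow_succ']
    exact h.mul ih

/-- `x₀⁻¹ ^ k` slides the two leaves up the vine, `c₁⁻¹` rotates `10` to `0`, and `x₁` trims `100`
to `10` when the second leaf is not the last. Two leaves alone have no room for this, whence `2 ≤
n`. -/
theorem exists_lin_consecutive {n : ℕ} (hn : 2 ≤ n) {p l : List BinWord} {x y : BinWord}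
    (h : (vine n).branches = p ++ x :: y :: l) :
    ∃ c ∈ Subgroup.closure Kind.V.generators, Lin c x [false] ∧ Lin c y [true, false] := by
  have h0 : x₀ ∈ Subgroup.closure Kind.V.generators :=
    Subgroup.subset_closure (by simp [Kind.generators])
  have h1 : x₁ ∈ Subgroup.closure Kind.V.generators :=
    Subgroup.subset_closure (by simp [Kind.generators])
  have h2 : c₁ ∈ Subgroup.closure Kind.V.generators :=
    Subgroup.subset_closure (by simp [Kind.generators])
  obtain ⟨rfl, hy⟩ := vine_consecutive h
  obtain hp | ⟨k, hk⟩ : p.length = 0 ∨ ∃ k, p.length = k + 1 := by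
    rcases p.length with _ | k
    · exact .inl rfl
    · exact .inr ⟨k, rfl⟩
  · rw [hp] at hy ⊢
    rcases hy with rfl | ⟨-, rfl⟩
    · exact ⟨1, one_mem _, Lin.one _, Lin.one _⟩
    · omega
  · rw [hk] at hy ⊢
    have hx : Lin (x₀⁻¹ ^ k * c₁⁻¹) (List.replicate (k + 1) true ++ [false]) [false] := by
      have := x₀_inv_pow_lin k [false]
      rw [List.append_cons, ← List.replicate_succ'] at this
      exact this.mul c₁_lin.1.inv
    have hm := mul_mem (pow_mem (inv_mem h0) k) (inv_mem h2)
    rcases hy with rfl | ⟨rfl, -⟩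
    · refine ⟨x₀⁻¹ ^ k * c₁⁻¹ * x₁, mul_mem hm h1, hx.mul x₁_lin.1, ?_⟩
      have := x₀_inv_pow_lin k [true, false]
      rw [List.append_cons, List.append_cons, ← List.replicate_succ', ← List.replicate_succ']
        at this
      exact (this.mul (c₁_lin.2.1.inv.append [false])).mul x₁_lin.2.1
    · refine ⟨x₀⁻¹ ^ k * c₁⁻¹, hm, hx, ?_⟩
      have := x₀_inv_pow_lin k [true]
      rw [List.append_cons, ← List.replicate_succ', ← List.replicate_succ'] at this
      exact this.mul c₁_lin.2.1.inv

theorem exists_swap_consecutive {n : ℕ} (hn : 2 ≤ n) {p l : List BinWord} {x y : BinWord}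
    (h : (vine n).branches = p ++ x :: y :: l) :
    ∃ τ ∈ Subgroup.closure Kind.V.generators,
      List.Forall₂ (Lin τ) (vine n).branches (p ++ y :: x :: l) := by
  obtain ⟨c, hc, hx, hy⟩ := exists_lin_consecutive hn h
  have hπ : π₀ ∈ Subgroup.closure Kind.V.generators :=
    Subgroup.subset_closure (by simp [Kind.generators])
  refine ⟨c * π₀ * c⁻¹, mul_mem (mul_mem hc hπ) (inv_mem hc), ?_⟩
  have hnd := (vine n).nodup_branches
  have hfix : ∀ u ∈ (vine n).branches, u ≠ x → u ≠ y → Lin (c * π₀ * c⁻¹) u u := by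
    intro u hu hux huy z
    have hxm : x ∈ (vine n).branches := by rw [h]; simp
    have hym : y ∈ (vine n).branches := by rw [h]; simp
    suffices H : π₀.unop (c.unop (u ++ₛ z)) = c.unop (u ++ₛ z) by
      rw [mul_apply, mul_apply, H]
      exact c.unop.symm_apply_apply _
    -- The cones of `0` and `10` are filled by the images of `x` and `y`, so any other leaf lands in
    -- the cone of `11`, which `π₀` fixes.
    obtain ⟨v, hv, s, hs⟩ := (vine 2).exists_branch (c.unop (u ++ₛ z))
    have hv' : v = [false] ∨ v = [true, false] ∨ v = [true, true] := by
      simpa [vine, FullTree.branches] using hv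
    rcases hv' with rfl | rfl | rfl
    · rw [← hx s] at hs
      exact absurd ((vine n).branch_unique hu hxm (c.unop.injective hs)).1 hux
    · rw [← hy s] at hs
      exact absurd ((vine n).branch_unique hu hym (c.unop.injective hs)).1 huy
    · rw [hs, π₀_lin.2.2]
  rw [h] at hnd hfix ⊢
  have hd := List.nodup_append.1 hnd
  refine List.rel_append (List.forall₂_same.2 fun u hu => ?_) (.cons ?_ (.cons ?_
    (List.forall₂_same.2 fun u hu => ?_)))
  · exact hfix u (by simp [hu]) (hd.2.2 u hu x (by simp)) (hd.2.2 u hu y (by simp))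
  · exact (hx.mul π₀_lin.1).mul hy.inv
  · exact (hy.mul π₀_lin.2.1).mul hx.inv
  · have h2 := hd.2.1
    simp only [List.nodup_cons, List.mem_cons, not_or] at h2
    refine hfix u (by simp [hu]) ?_ ?_
    · rintro rfl; exact h2.1.2 hu
    · rintro rfl; exact h2.2.1 hu

/-- Permutations are generated by adjacent transpositions. The prefix `p` is what lets the induction
pass under a common head. -/
theorem exists_forall₂_perm {n : ℕ} (hn : 2 ≤ n) {l₁ l₂ : List BinWord} (h : l₁.Perm l₂) :
    ∀ p, (∃ k ∈ Subgroup.closure Kind.V.generators,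
      List.Forall₂ (Lin k) (vine n).branches (p ++ l₁)) →
      ∃ k ∈ Subgroup.closure Kind.V.generators,
        List.Forall₂ (Lin k) (vine n).branches (p ++ l₂) := by
  induction h with
  | nil => exact fun p h => h
  | cons a _ ih =>
    intro p h
    rw [List.append_cons] at h ⊢
    exact ih _ h
  | trans _ _ ih1 ih2 => exact fun p h => ih2 p (ih1 p h)
  | swap x y l =>
    rintro p ⟨k, hk, hl⟩
    have h1 := List.forall₂_take_append _ _ _ hl
    have h2 := List.forall₂_drop_append _ _ _ hl
    have h3 := List.take_append_drop p.length (vine n).branches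
    generalize (vine n).branches.take p.length = p' at h1 h3
    generalize (vine n).branches.drop p.length = d at h2 h3
    obtain ⟨x', d, hx, h4, rfl⟩ := List.forall₂_cons_right_iff.1 h2
    obtain ⟨y', d, hy, h5, rfl⟩ := List.forall₂_cons_right_iff.1 h4
    obtain ⟨τ, hτ, hτl⟩ := exists_swap_consecutive hn h3.symm
    exact ⟨τ * k, mul_mem hτ hk,
      forall₂_lin_mul hτl (List.rel_append h1 (.cons hy (.cons hx h5)))⟩

/-- Once both trees are straightened to the same vine by elements of `F`, what remains of `g` is a
permutation of the leaves of that vine. -/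
theorem mem_closure_of_represents {D : TreeDiagram} {g : CantorPerm} (hg : D.Represents g)
    (hD : 3 ≤ D.numLeaves) : g ∈ Subgroup.closure Kind.V.generators := by
  have hsub : Subgroup.closure ({x₀, x₁} : Set CantorPerm) ≤
      Subgroup.closure Kind.V.generators :=
    Subgroup.closure_mono (by
      intro a
      simp only [Kind.generators, Set.mem_insert_iff, Set.mem_singleton_iff]
      tauto)
  obtain ⟨m, h, hh, hl⟩ := exists_forall₂_vine D.dom
  obtain ⟨n, k, hk, hl'⟩ := exists_forall₂_vine D.ran
  have h2 := hg.forall₂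
  obtain ⟨s, hs, hsp⟩ := List.perm_comp_forall₂ D.snd_perm hl'
  have hlen : n = m ∧ 2 ≤ n := by
    have h3 := hl.length_eq
    have h4 := hl'.length_eq
    have h5 := h2.length_eq
    have h6 := D.snd_perm.length_eq
    rw [length_branches_vine] at h3 h4
    rw [List.length_map] at h5 h6
    unfold TreeDiagram.numLeaves at hD
    omega
  obtain ⟨rfl, hn⟩ := hlen
  obtain ⟨e, he, hel⟩ := exists_forall₂_perm hn hsp.symm [] ⟨1, one_mem _, forall₂_lin_one _⟩
  have h7 := eq_of_forall₂_lin hel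
    (forall₂_lin_mul (forall₂_lin_inv hl) (forall₂_lin_mul h2 hs))
  have h8 : g = h * e * k⁻¹ := by rw [h7]; group
  rw [h8]
  exact mul_mem (mul_mem (hsub hh) he) (inv_mem (hsub hk))

theorem mem_closure_generators {𝒢 : Kind} {g : CantorPerm} (hg : g ∈ 𝒢.group)
    (h4 : 4 ≤ leafNumber g) : g ∈ Subgroup.closure 𝒢.generators := by
  cases 𝒢 with
  | F => exact groupF_le_closure hg
  | T => exact groupT_le_closure hg
  | V =>
    -- The infimum of the empty set is 0, so the bound on `leafNumber` itself supplies a reduced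
    -- diagram.
    have hne : {n | ∃ D : TreeDiagram, D.IsReduced ∧ D.Represents g ∧ D.numLeaves = n}.Nonempty :=
      Nat.nonempty_of_pos_sInf (lt_of_lt_of_le (by norm_num) h4)
    obtain ⟨D, -, hD, hn⟩ := Nat.sInf_mem hne
    change D.numLeaves = leafNumber g at hn
    exact mem_closure_of_represents hD (by omega)

theorem ne_one_of_le_leafNumber {g : CantorPerm} (h4 : 4 ≤ leafNumber g) : g ≠ 1 := by
  rintro rfl
  have h : leafNumber 1 ≤ 1 := Nat.sInf_le
    ⟨⟨.leaf, .leaf, [([], [])], rfl, .refl _⟩, by simp [TreeDiagram.IsReduced],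
      fun p hp x => by rw [List.mem_singleton] at hp; subst hp; rfl, rfl⟩
  omega

/-! ### Linearity of short elements on deep cones -/

theorem exists_lin_of_branches {T : FullTree} {f : CantorPerm}
    (H : ∀ p ∈ T.branches, p.length ≤ 3 ∧
      ∃ q, Lin f p q ∧ p.length ≤ q.length + 1 ∧ q.length ≤ p.length + 1)
    (u : BinWord) (hu : 3 ≤ u.length) :
    ∃ v, Lin f u v ∧ u.length ≤ v.length + 1 ∧ v.length ≤ u.length + 1 := by
  obtain ⟨p, hp, y, hy⟩ := T.exists_branch (u ++ₛ Stream'.const false)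
  obtain ⟨hp3, q, hq, h1, h2⟩ := H p hp
  obtain ⟨t, rfl, -⟩ := exists_append_of_append_eq hy (hp3.trans hu)
  refine ⟨q ++ t, hq.append t, ?_, ?_⟩ <;> simp only [List.length_append] <;> omega

theorem TreeDiagram.exists_lin {D : TreeDiagram}
    (hD : ∀ p ∈ D.branches, p.1.length ≤ 3 ∧ p.2.length ≤ 3 ∧ p.1.length ≤ p.2.length + 1 ∧
      p.2.length ≤ p.1.length + 1) {f : CantorPerm} (hf : f = D.toPerm ∨ f⁻¹ = D.toPerm)
    (u : BinWord) (hu : 3 ≤ u.length) :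
    ∃ v, Lin f u v ∧ u.length ≤ v.length + 1 ∧ v.length ≤ u.length + 1 := by
  have h := D.represents_toPerm
  rcases hf with rfl | hf
  · refine exists_lin_of_branches (T := D.dom) (fun p hp => ?_) u hu
    rw [← D.fst_eq, List.mem_map] at hp
    obtain ⟨q, hq, rfl⟩ := hp
    exact ⟨(hD q hq).1, q.2, h q hq, (hD q hq).2.2⟩
  · rw [inv_eq_iff_eq_inv] at hf
    subst hf
    refine exists_lin_of_branches (T := D.ran) (fun p hp => ?_) u hu
    rw [← D.snd_perm.mem_iff, List.mem_map] at hp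
    obtain ⟨q, hq, rfl⟩ := hp
    exact ⟨(hD q hq).2.1, q.1, Lin.inv (h q hq), (hD q hq).2.2.2, (hD q hq).2.2.1⟩

theorem exists_lin_of_generator {f : CantorPerm}
    (hf : f ∈ Kind.V.generators ∨ f⁻¹ ∈ Kind.V.generators) (u : BinWord) (hu : 3 ≤ u.length) :
    ∃ v, Lin f u v ∧ u.length ≤ v.length + 1 ∧ v.length ≤ u.length + 1 := by
  have H : (f = x₀ ∨ f⁻¹ = x₀) ∨ (f = x₁ ∨ f⁻¹ = x₁) ∨ (f = c₁ ∨ f⁻¹ = c₁) ∨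
      (f = π₀ ∨ f⁻¹ = π₀) := by
    simp only [Kind.generators, Set.mem_insert_iff, Set.mem_singleton_iff] at hf
    tauto
  rcases H with h | h | h | h
  · exact TreeDiagram.exists_lin (by simp [x₀Diagram]) h u hu
  · exact TreeDiagram.exists_lin (by simp [x₁Diagram]) h u hu
  · exact TreeDiagram.exists_lin (by simp [c₁Diagram]) h u hu
  · exact TreeDiagram.exists_lin (by simp [π₀Diagram]) h u hu

/-- The trees of the generators have depth at most 3, so a letter acts by prefix replacement on a
cone of depth at least 3. Each letter may shorten the prefix by one, and depth `w.length + 2` leaves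
3 for the last letter. -/
theorem exists_lin_of_isWord {w : List CantorPerm} (hw : IsWord Kind.V.generators w)
    (u : BinWord) (hu : w.length + 2 ≤ u.length) :
    ∃ v, Lin w.prod u v ∧ u.length ≤ v.length + w.length ∧ v.length ≤ u.length + w.length := by
  induction w generalizing u with
  | nil => exact ⟨u, Lin.one u, le_rfl, le_rfl⟩
  | cons s w ih =>
    rw [List.length_cons] at hu
    obtain ⟨v, hv, h1, h2⟩ := exists_lin_of_generator (hw s (by simp)) u (by omega)
    obtain ⟨t, ht, h3, h4⟩ := ih (fun a ha => hw a (by simp [ha])) v (by omega)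
    refine ⟨t, ?_, ?_, ?_⟩
    · rw [List.prod_cons]; exact hv.mul ht
    · rw [List.length_cons]; omega
    · rw [List.length_cons]; omega

section LowerBounds

variable {X : Set CantorPerm}

theorem exists_lin (hX : X ⊆ Kind.V.generators) {f : CantorPerm}
    (hf : f ∈ Subgroup.closure X) (u : BinWord) (hu : wordLength X f + 2 ≤ u.length) :
    ∃ v, Lin f u v ∧ u.length ≤ v.length + wordLength X f ∧
      v.length ≤ u.length + wordLength X f := by
  obtain ⟨w, hw, rfl, hl⟩ := exists_word_length_eq hf
  rw [← hl] at hu ⊢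
  exact exists_lin_of_isWord (hw.mono hX) u hu

/-- A shorter product would replace prefixes on the cone of `v`; since `r` does so too, `x₀` itself
would have to. -/
theorem length_le_wordLength_sub_mul (hX : X ⊆ Kind.V.generators) {v u : BinWord}
    {r : CantorPerm} (hr : Lin r v u) (h : sub v x₀ * r ∈ Subgroup.closure X) :
    v.length ≤ wordLength X (sub v x₀ * r) + 1 := by
  by_contra hlt
  obtain ⟨t, ht, -⟩ := exists_lin hX h v (by omega)
  refine x₀_apply_not_lin (a := u) (b := t) fun z => ?_
  rw [← ht, mul_apply, sub_append_stream, hr]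

end LowerBounds

/-! ### Behaviour at the end points -/

/-- Near the end point `bbb…`, the map `h` replaces the prefix `b^(N+c)` by `b^(N+d)`. -/
def Germ (b : Bool) (h : CantorPerm) (c d : ℕ) : Prop :=
  ∃ M, ∀ N, M ≤ N → Lin h (List.replicate (N + c) b) (List.replicate (N + d) b)

theorem Germ.mul {b : Bool} {f g : CantorPerm} {c d c' d' : ℕ} (hf : Germ b f c d)
    (hg : Germ b g c' d') : Germ b (f * g) (c + c') (d + d') := by
  obtain ⟨M, hM⟩ := hf
  obtain ⟨M', hM'⟩ := hg
  refine ⟨M + M', fun N hN => Lin.mul (v := List.replicate (N + d + c') b) ?_ ?_⟩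
  · have := hM (N + c') (by omega)
    rwa [show N + c' + c = N + (c + c') by omega, show N + c' + d = N + d + c' by omega] at this
  · have := hM' (N + d) (by omega)
    rwa [add_assoc N d d'] at this

theorem Lin.germ {b : Bool} {f : CantorPerm} {i j c d : ℕ}
    (h : Lin f (List.replicate i b) (List.replicate j b)) (hij : i + d = j + c) :
    Germ b f c d := by
  refine ⟨i + j, fun N hN => ?_⟩
  have := h.append (List.replicate (N + c - i) b)
  rwa [← List.replicate_add, ← List.replicate_add, show i + (N + c - i) = N + c by omega,
    show j + (N + c - i) = N + d by omega] at this

/-- The element of `{x₀, x₀⁻¹}` that expands a neighbourhood of the end point `bbb…`. -/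
noncomputable def stretch : Bool → CantorPerm
  | false => x₀
  | true => x₀⁻¹

theorem germ_stretch_pow (b : Bool) (j : ℕ) : Germ b (stretch b ^ j) j 0 := by
  induction j with
  | zero => exact ⟨0, fun N _ => Lin.one _⟩
  | succ j ih =>
    rw [pow_succ]
    refine ih.mul (Lin.germ (i := 2) (j := 1) (c := 1) (d := 0) ?_ rfl)
    cases b
    · exact x₀_lin.1
    · exact x₀_lin.2.2.inv

theorem germ_sub_replicate (b : Bool) (K : ℕ) :
    ∃ c d, d ≤ 1 ∧ Germ b (sub (List.replicate K b) x₀) c d := by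
  cases b
  · refine ⟨1, 0, by simp, Lin.germ (i := K + 2) (j := K + 1) ?_ (by omega)⟩
    rw [List.replicate_add, List.replicate_add]
    exact x₀_lin.1.sub _
  · refine ⟨0, 1, le_rfl, Lin.germ (i := K + 1) (j := K + 2) ?_ (by omega)⟩
    rw [List.replicate_add, List.replicate_add]
    exact x₀_lin.2.2.sub _

theorem not_prefix_replicate {b : Bool} {v : BinWord} (hv : v ≠ List.replicate v.length b)
    (N : ℕ) : ¬ v <+: List.replicate N b := by
  intro h
  exact hv (List.eq_replicate_iff.2 ⟨rfl, fun a ha => List.eq_of_mem_replicate (h.subset ha)⟩)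

theorem germ_sub {b : Bool} {v : BinWord} (hv : v ≠ List.replicate v.length b)
    (f : CantorPerm) : Germ b (sub v f) 0 0 := by
  refine ⟨v.length + 1, fun N hN => sub_lin_self f (fun h => ?_) (not_prefix_replicate hv N)⟩
  have := h.length_le
  rw [List.length_replicate] at this
  omega

section EndPoints

variable {X : Set CantorPerm}

theorem stretch_mem_or (h0 : x₀ ∈ X) (b : Bool) : stretch b ∈ X ∨ (stretch b)⁻¹ ∈ X := by
  cases b
  · exact .inl h0
  · exact .inr (by simpa [stretch] using h0)

theorem stretch_mem (h0 : x₀ ∈ X) (b : Bool) : stretch b ∈ Subgroup.closure X := by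
  cases b
  · exact Subgroup.subset_closure h0
  · exact inv_mem (Subgroup.subset_closure h0)

/-- The expansion exponent `c - d` at the end point is seen on every deep enough cone around it,
where the length of `h` bounds the change of depth. -/
theorem Germ.le_wordLength {b : Bool} {h : CantorPerm} {c d : ℕ} (hg : Germ b h c d)
    (hX : X ⊆ Kind.V.generators) (hh : h ∈ Subgroup.closure X) : c ≤ d + wordLength X h := by
  obtain ⟨M, hM⟩ := hg
  have h1 := hM (M + wordLength X h + 2) (by omega)
  obtain ⟨t, ht, h2, -⟩ := exists_lin hX hh
    (List.replicate (M + wordLength X h + 2 + c) b) (by rw [List.length_replicate]; omega)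
  have h3 := length_eq_of_append_eq fun z => (h1 z).symm.trans (ht z)
  rw [List.length_replicate] at h2 h3
  omega

/-- Along the ray the expansion at `bbb…` grows by one per step. As `h` contracts by at most one
there, `j` is at most one more than the length of the product, so the ray cannot cancel much of `h`.
-/
theorem wordLength_le_mul_stretch_pow (hX : X ⊆ Kind.V.generators) (h0 : x₀ ∈ X)
    {b : Bool} {h : CantorPerm} {c d : ℕ} (hg : Germ b h c d) (hd : d ≤ 1) (hh : h ∈ Subgroup.closure X) (j : ℕ) :
    wordLength X h ≤ 2 * wordLength X (h * stretch b ^ j) + 1 := by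
  have hs := pow_mem (stretch_mem h0 b) j
  have h1 := (hg.mul (germ_stretch_pow b j)).le_wordLength hX (mul_mem hh hs)
  have h2 := wordLength_mul_le (mul_mem hh hs) (inv_mem hs)
  rw [mul_inv_cancel_right] at h2
  have h3 := wordLength_inv_le hs
  have h4 := wordLength_pow_le (stretch_mem_or h0 b) j
  omega

/-- Suppose both rays enter the ball of radius `n/4`, where `n` is the length of `g`. The first
needs `j ≥ 3n/4` steps for this, yet the two points in the ball are at distance at most `n/2` and
differ by `x₀ ^ (k + j)`, whose length is at least `k + j`. -/
theorem exists_stretch_avoids (hX : X ⊆ Kind.V.generators) (h0 : x₀ ∈ X)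
    {g : CantorPerm} (hg : g ∈ Subgroup.closure X) (hpos : 0 < wordLength X g) :
    ∃ b, ∀ j, wordLength X g < 4 * wordLength X (g * stretch b ^ j) := by
  by_contra hcon
  push Not at hcon
  obtain ⟨j, hj⟩ := hcon false
  obtain ⟨k, hk⟩ := hcon true
  have hs := pow_mem (stretch_mem h0 false) j
  have hs' := pow_mem (stretch_mem h0 true) k
  have h1 := wordLength_mul_le (mul_mem hg hs) (inv_mem hs)
  rw [mul_inv_cancel_right] at h1
  have h2 := wordLength_inv_le hs
  have h3 := wordLength_pow_le (stretch_mem_or h0 false) j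
  have h4 := wordLength_mul_le (inv_mem (mul_mem hg hs')) (mul_mem hg hs)
  have h5 := wordLength_inv_le (mul_mem hg hs')
  have h6 : (g * stretch true ^ k)⁻¹ * (g * stretch false ^ j) = stretch false ^ (k + j) := by
    simp only [stretch, pow_add, inv_pow]
    group
  have h7 := (germ_stretch_pow false (k + j)).le_wordLength hX (pow_mem (stretch_mem h0 false) _)
  rw [h6] at h4
  omega

end EndPoints

/-! ### Paths in Cayley graphs -/

section Paths

variable {G : Type*} [Group G] {X : Set G} {P : G → Prop}

/-- In the Cayley graph with respect to `X`, there is a path of length `n` from the first vertex to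
the second, all of whose vertices satisfy `P`. -/
inductive Joined (X : Set G) (P : G → Prop) : ℕ → G → G → Prop
  | refl {a : G} (h : P a) : Joined X P 0 a a
  | step {n : ℕ} {a b s : G} (h : Joined X P n a b) (hs : s ∈ X ∨ s⁻¹ ∈ X) (hP : P (b * s)) :
      Joined X P (n + 1) a (b * s)

theorem Joined.target {n : ℕ} {a b : G} (h : Joined X P n a b) : P b := by
  cases h <;> assumption

theorem Joined.trans {m n : ℕ} {a b c : G} (h : Joined X P m a b) (h' : Joined X P n b c) :
    Joined X P (m + n) a c := by
  induction h' with
  | refl _ => exact h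
  | step _ hs hP ih => exact (ih h).step hs hP

theorem Joined.symm {n : ℕ} {a b : G} (h : Joined X P n a b) : Joined X P n b a := by
  induction h with
  | refl h => exact .refl h
  | @step n a b s h hs hP ih =>
    have h1 : Joined X P 1 (b * s) b := by
      have h2 := (Joined.refl (X := X) hP).step (s := s⁻¹) (by rwa [inv_inv, or_comm])
        (by rw [mul_inv_cancel_right]; exact h.target)
      rwa [mul_inv_cancel_right] at h2
    rw [add_comm]
    exact h1.trans ih

theorem Joined.exists_word {n : ℕ} {a b : G} (h : Joined X P n a b) :
    ∃ w, IsWord X w ∧ w.length = n ∧ (∀ w', w' <+: w → P (a * w'.prod)) ∧ a * w.prod = b := by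
  induction h with
  | refl h =>
    refine ⟨[], by simp [IsWord], rfl, fun w' hw' => ?_, by simp⟩
    rw [List.prefix_nil.1 hw']
    simpa using h
  | @step n a b s h hs hP ih =>
    obtain ⟨w, hw, rfl, hw', rfl⟩ := ih
    have hprod : a * (w ++ [s]).prod = a * w.prod * s := by
      rw [List.prod_append, List.prod_singleton, mul_assoc]
    refine ⟨w ++ [s], hw.append (by simpa [IsWord] using hs), by simp, fun v hv => ?_, hprod⟩
    rcases List.prefix_concat_iff.1 hv with rfl | hv
    · rwa [hprod]
    · exact hw' v hv

theorem joined_word {w : List G} (hw : IsWord X w) {a : G}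
    (hP : ∀ w', IsWord X w' → w'.length ≤ w.length → P (a * w'.prod)) :
    Joined X P w.length a (a * w.prod) := by
  induction w using List.reverseRecOn with
  | nil => simpa using Joined.refl (X := X) (hP [] hw le_rfl)
  | append_singleton w s ih =>
    have h1 : a * (w ++ [s]).prod = a * w.prod * s := by
      rw [List.prod_append, List.prod_singleton, mul_assoc]
    have h2 := hP _ hw le_rfl
    rw [h1] at h2 ⊢
    rw [List.length_append, List.length_singleton]
    exact (ih (fun b hb => hw b (by simp [hb])) fun w' h h' => hP w' h (by simp; omega)).step
      (hw s (by simp)) h2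

theorem joined_pow {x a : G} (hx : x ∈ X ∨ x⁻¹ ∈ X) (hP : ∀ j, P (a * x ^ j)) (k : ℕ) :
    Joined X P k a (a * x ^ k) := by
  induction k with
  | zero => simpa using Joined.refl (X := X) (by simpa using hP 0)
  | succ k ih =>
    have h := hP (k + 1)
    rw [pow_succ, ← mul_assoc] at h ⊢
    exact ih.step hx h

end Paths

/-! ### Paths that avoid a ball around the identity -/

theorem sub_replicate_mul_stretch_pow (b : Bool) (K : ℕ) :
    ∃ y, (y ∈ ({x₀, x₁} : Set CantorPerm) ∨ y⁻¹ ∈ ({x₀, x₁} : Set CantorPerm)) ∧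
      ∃ i j, i ≤ K + 2 ∧ j ≤ K + 1 ∧
        stretch b ^ i * y = sub (List.replicate (K + 1) b) x₀ * stretch b ^ j := by
  cases b
  · refine ⟨x₁⁻¹, by simp, K + 2, K + 1, le_rfl, le_rfl, ?_⟩
    rw [sub_replicate_false, mul_assoc, stretch, ← (Commute.refl x₀).inv_left.mul_pow]
    simp
  · refine ⟨x₁, by simp, K, K, by omega, by omega, ?_⟩
    rw [sub_replicate_true, mul_assoc, stretch, ← (Commute.refl x₀).inv_right.mul_pow]
    simp

/-- The path goes out along the ray from `a`, crosses by one letter `x₁^±1`, and returns along the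
ray that starts at the end point; only these two rays need to be safe. -/
theorem joined_sub_replicate {X : Set CantorPerm} {P : CantorPerm → Prop}
    (hX : ({x₀, x₁} : Set CantorPerm) ⊆ X) (b : Bool) (K : ℕ) {a : CantorPerm}
    (h1 : ∀ j, P (a * stretch b ^ j))
    (h2 : ∀ j, P (a * sub (List.replicate (K + 1) b) x₀ * stretch b ^ j)) :
    ∃ n ≤ 2 * K + 4, Joined X P n a (a * sub (List.replicate (K + 1) b) x₀) := by
  have hs := stretch_mem_or (hX (by simp)) b
  obtain ⟨y, hy, i, j, hi, hj, hij⟩ := sub_replicate_mul_stretch_pow b K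
  have h3 := joined_pow hs h2 j
  have h4 : a * stretch b ^ i * y = a * sub (List.replicate (K + 1) b) x₀ * stretch b ^ j := by
    rw [mul_assoc, hij, mul_assoc]
  have h5 := (joined_pow hs h1 i).step (hy.imp (@hX _) (@hX _)) (h4 ▸ h2 j)
  rw [h4] at h5
  exact ⟨i + 1 + j, by omega, h5.trans h3.symm⟩

theorem exists_word_sub : ∃ c : ℕ, ∀ v : BinWord, v ≠ [] →
    ∃ w, IsWord ({x₀, x₁} : Set CantorPerm) w ∧ w.prod = sub v x₀ ∧
      w.length ≤ 4 * v.length + c := by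
  have h0 : x₀ ∈ Subgroup.closure ({x₀, x₁} : Set CantorPerm) :=
    Subgroup.subset_closure (by simp)
  have h1 : x₁ ∈ Subgroup.closure ({x₀, x₁} : Set CantorPerm) :=
    Subgroup.subset_closure (by simp)
  have h2 : sub [false] x₀ ∈ Subgroup.closure ({x₀, x₁} : Set CantorPerm) := by
    rw [sub_false_x₀]
    exact mul_mem (mul_mem (pow_mem h0 2) (inv_mem h1)) (inv_mem h0)
  obtain ⟨w₁, hw₁, hp₁, -⟩ := exists_word_length_eq h2
  obtain ⟨w₂, hw₂, hp₂, -⟩ := exists_word_length_eq h1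
  obtain ⟨w₃, hw₃, hp₃, -⟩ := exists_word_length_eq (copy_true_mem h2)
  -- The constant pays for the copies of `x₀` on the three normal forms; conjugation by a
  -- normalizing word costs twice its length.
  refine ⟨w₁.length + w₂.length + w₃.length, fun v hv => ?_⟩
  obtain ⟨a, t, ha, hl, hlin, ht⟩ := exists_word_lin v hv
  have H : ∃ w, IsWord ({x₀, x₁} : Set CantorPerm) w ∧ w.prod = sub t x₀ ∧
      w.length ≤ w₁.length + w₂.length + w₃.length := by
    rcases ht with rfl | rfl | rfl
    · exact ⟨w₁, hw₁, hp₁, by omega⟩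
    · exact ⟨w₂, hw₂, hp₂.trans sub_true_x₀.symm, by omega⟩
    · exact ⟨w₃, hw₃, hp₃, by omega⟩
  obtain ⟨w, hw, hp, hwl⟩ := H
  refine ⟨a ++ w ++ (a.map (·⁻¹)).reverse, (ha.append hw).append ha.inv, ?_, ?_⟩
  · rw [List.prod_append, List.prod_append, ← List.prod_inv_reverse, hp, conj_sub hlin,
      mul_inv_cancel_right]
  · simp only [List.length_append, List.length_reverse, List.length_map]
    omega

/-- A detour through a commuting copy `q` on a very deep cone at the safe end point: `g`, `g * q`,
`g * q * sub v x₀ = g * sub v x₀ * q`, `g * sub v x₀`. -/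
theorem exists_joined_mul_sub {X : Set CantorPerm} (hX : X ⊆ Kind.V.generators)
    (hX' : ({x₀, x₁} : Set CantorPerm) ⊆ X) {c : ℕ}
    (hc : ∀ v : BinWord, v ≠ [] → ∃ w, IsWord ({x₀, x₁} : Set CantorPerm) w ∧
      w.prod = sub v x₀ ∧ w.length ≤ 4 * v.length + c)
    {g : CantorPerm} (hg : g ∈ Subgroup.closure X) (hpos : 0 < wordLength X g) {v : BinWord}
    (hv : 17 * wordLength X g ≤ v.length) :
    ∃ N ≤ 24 * v.length + 20 * wordLength X g + 5 * c + 8,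
      Joined X (fun h => wordLength X g < 4 * wordLength X h) N g (g * sub v x₀) := by
  have h0 : x₀ ∈ X := hX' (by simp)
  have hcl : ∀ {v : BinWord}, v ≠ [] → sub v x₀ ∈ Subgroup.closure X := by
    intro v hv
    obtain ⟨w, hw, hp, -⟩ := hc v hv
    exact hp ▸ (hw.mono hX').prod_mem
  have hrep : ∀ (b : Bool) (K : ℕ), List.replicate (K + 1) b ≠ [] := fun b K => by simp
  have hne : v ≠ [] := by
    rintro rfl
    simp only [List.length_nil] at hv
    omega
  have hleft : ∀ {h : CantorPerm}, h ∈ Subgroup.closure X →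
      wordLength X h ≤ wordLength X (g * h) + wordLength X g := by
    intro h hh
    have h1 := wordLength_mul_le (inv_mem hg) (mul_mem hg hh)
    rw [inv_mul_cancel_left] at h1
    have := wordLength_inv_le hg
    omega
  -- A ray from `g * h` is safe when `h` is long: it keeps about half the length of `h`, and the
  -- factor `g` removes at most the length of `g`.
  have hstretch : ∀ (b : Bool) {h : CantorPerm} {k d : ℕ}, Germ b h k d → d ≤ 1 →
      h ∈ Subgroup.closure X → 5 * wordLength X g ≤ wordLength X h →
      ∀ j, wordLength X g < 4 * wordLength X (g * h * stretch b ^ j) := by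
    intro b h k d hk hd hh hl j
    have h1 := wordLength_le_mul_stretch_pow hX h0 hk hd hh j
    have h2 := hleft (mul_mem hh (pow_mem (stretch_mem h0 b) j))
    rw [← mul_assoc] at h2
    omega
  have hself : ∀ {v : BinWord}, v ≠ [] → v.length ≤ wordLength X (sub v x₀) + 1 := by
    intro v hv
    have := length_le_wordLength_sub_mul hX (Lin.one v) (by rw [mul_one]; exact hcl hv)
    rwa [mul_one] at this
  obtain ⟨b, hb⟩ := exists_stretch_avoids hX h0 hg hpos
  have hend : ∀ K, 5 * wordLength X g ≤ K → ∃ n ≤ 2 * K + 4,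
      Joined X (fun h => wordLength X g < 4 * wordLength X h) n g
        (g * sub (List.replicate (K + 1) b) x₀) := by
    intro K hK
    obtain ⟨k, d, hd, hgerm⟩ := germ_sub_replicate b (K + 1)
    refine joined_sub_replicate hX' b K hb (hstretch b hgerm hd (hcl (hrep b K)) ?_)
    have := hself (hrep b K)
    rw [List.length_replicate] at this
    omega
  by_cases hvb : v = List.replicate v.length b
  · obtain ⟨k, hk⟩ : ∃ k, v.length = k + 1 := ⟨v.length - 1, by omega⟩
    rw [hk] at hvb
    obtain ⟨N, hN, hJ⟩ := hend k (by omega)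
    rw [← hvb] at hJ
    exact ⟨N, by omega, hJ⟩
  · obtain ⟨w, hw, hp, hwl⟩ := hc v hne
    have hw' := hw.mono hX'
    -- The three terms make `b^(K+1)` too deep for prefixes of `w`, make `q` long compared with `g`,
    -- and keep `b^(K+1)` from being a prefix of `v`.
    generalize hK : w.length + 5 * wordLength X g + v.length = K at *
    obtain ⟨N, hN, hJ⟩ := hend K (by omega)
    have hq := hcl (hrep b K)
    have h1 : Joined X (fun h => wordLength X g < 4 * wordLength X h) w.length
        (g * sub (List.replicate (K + 1) b) x₀)
        (g * sub (List.replicate (K + 1) b) x₀ * sub v x₀) := by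
      rw [← hp]
      refine joined_word hw' fun w' hw' hl => ?_
      have hm := mul_mem hq hw'.prod_mem
      -- `w'` only replaces the prefix `b^(K+1)`, so `q * w'` keeps length at least `K`.
      obtain ⟨t, ht, -⟩ := exists_lin_of_isWord (hw'.mono hX) (List.replicate (K + 1) b)
        (by rw [List.length_replicate]; omega)
      have h2 := length_le_wordLength_sub_mul hX ht hm
      have h3 := hleft hm
      rw [List.length_replicate] at h2
      rw [← mul_assoc] at h3
      omega
    have hinc : ¬ v <+: List.replicate (K + 1) b := not_prefix_replicate hvb _
    have hinc' : ¬ List.replicate (K + 1) b <+: v := fun h => by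
      have := h.length_le
      rw [List.length_replicate] at this
      omega
    have h4 := hself hne
    have h5 : v.length ≤ wordLength X (sub v x₀ * sub (List.replicate (K + 1) b) x₀) + 1 :=
      length_le_wordLength_sub_mul hX (sub_lin_self x₀ hinc hinc') (mul_mem (hcl hne) hq)
    obtain ⟨k, d, hd, hgerm⟩ := germ_sub_replicate b (K + 1)
    obtain ⟨M, hM, hJ'⟩ := joined_sub_replicate (a := g * sub v x₀)
      (P := fun h => wordLength X g < 4 * wordLength X h) hX' b K
      -- As `v` is not a power of `b`, `sub v x₀` is trivial near `bbb…` and does not affect the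
      -- germ of `q`.
      (hstretch b (germ_sub hvb x₀) (by omega) (hcl hne) (by omega)) (by
        rw [mul_assoc g]
        exact hstretch b ((germ_sub hvb x₀).mul hgerm) (by omega) (mul_mem (hcl hne) hq) (by omega))
    rw [mul_assoc, sub_comm x₀ x₀ hinc' hinc, ← mul_assoc] at h1
    exact ⟨N + w.length + M, by omega, (hJ.trans h1).trans hJ'.symm⟩

theorem exists_joined_target {X : Set CantorPerm} (hX : X ⊆ Kind.V.generators)
    (hX' : ({x₀, x₁} : Set CantorPerm) ⊆ X) {c : ℕ}
    (hc : ∀ v : BinWord, v ≠ [] → ∃ w, IsWord ({x₀, x₁} : Set CantorPerm) w ∧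
      w.prod = sub v x₀ ∧ w.length ≤ 4 * v.length + c)
    {g : CantorPerm} (hg : g ∈ Subgroup.closure X) (hpos : 0 < wordLength X g) :
    ∃ N ≤ 525 * wordLength X g + 5 * c + 8,
      Joined X (fun h => wordLength X g < 4 * wordLength X h) N g
        (sub (List.replicate (20 * wordLength X g - 1) false) x₀) := by
  generalize hp : List.replicate (20 * wordLength X g - 1) false = p
  have hpl : p.length = 20 * wordLength X g - 1 := by rw [← hp, List.length_replicate]
  -- The depth of `v` lies between `19n - 1` and `21n - 1`, where `n` is the length of `g`: enough
  -- for the detour, and still linear in `n`.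
  obtain ⟨v, hv, h1, h2⟩ := exists_lin hX hg p (by omega)
  obtain ⟨N, hN, hJ⟩ := exists_joined_mul_sub hX hX' hc hg hpos (v := v) (by omega)
  have hpc : sub p x₀ ∈ Subgroup.closure X := by
    obtain ⟨w, hw, hwp, -⟩ := hc p (by rintro rfl; simp at hpl; omega)
    exact hwp ▸ (hw.mono hX').prod_mem
  obtain ⟨w, hw, hwp, hwl⟩ := exists_word_length_eq (inv_mem hg)
  have h3 := wordLength_inv_le hg
  have h4 := length_le_wordLength_sub_mul hX (Lin.one p) (by rwa [mul_one])
  rw [mul_one] at h4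
  have h5 : Joined X (fun h => wordLength X g < 4 * wordLength X h) w.length
      (sub p x₀ * g) (sub p x₀ * g * w.prod) := by
    refine joined_word hw fun w' hw' hl => ?_
    have hgw := mul_mem hg hw'.prod_mem
    have h6 := wordLength_mul_le (mul_mem hpc hgw) (inv_mem hgw)
    rw [mul_inv_cancel_right, ← mul_assoc] at h6
    have h7 := wordLength_inv_le hgw
    have h8 := wordLength_mul_le hg hw'.prod_mem
    have h9 := wordLength_prod_le hw'
    omega
  rw [hwp, mul_inv_cancel_right, ← conj_sub hv] at h5
  exact ⟨N + w.length, by omega, hJ.trans h5⟩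

theorem wordLength_pos {G : Type*} [Group G] {X : Set G} {g : G} (hg : g ∈ Subgroup.closure X)
    (h1 : g ≠ 1) : 0 < wordLength X g := by
  obtain ⟨w, -, hw, hl⟩ := exists_word_length_eq hg
  rw [← hl, List.length_pos_iff]
  rintro rfl
  exact h1 hw.symm

end Thompson

theorem mainTheorem3 :
    ∃ (δ D : ℝ) (Q : ℕ), 0 < δ ∧ 0 < D ∧ 0 < Q ∧
      ∀ (𝒢 : Thompson.Kind) (g : Thompson.CantorPerm), g ∈ 𝒢.group →
        4 ≤ Thompson.leafNumber g →
        ∃ w : List Thompson.CantorPerm,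
          Thompson.IsWord 𝒢.generators w ∧
          (w.length : ℝ) < D * (Thompson.wordLength 𝒢.generators g : ℝ) ∧
          (∀ w' : List Thompson.CantorPerm, w' <+: w →
            δ * (Thompson.wordLength 𝒢.generators g : ℝ) <
              (Thompson.wordLength 𝒢.generators (g * w'.prod) : ℝ)) ∧
          g * w.prod =
            Thompson.x₀ ^ (Q * Thompson.wordLength 𝒢.generators g) * Thompson.x₁⁻¹ *
              Thompson.x₀ ^ (-((Q * Thompson.wordLength 𝒢.generators g : ℕ) : ℤ) + 1) := by
  obtain ⟨c, hc⟩ := Thompson.exists_word_sub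
  -- As `n ≥ 1`, the path length `525n + 5c + 8` is below `(540 + 5c)n`.
  refine ⟨1 / 4, 540 + 5 * c, 20, by norm_num, by positivity, by norm_num, fun 𝒢 g hg h4 => ?_⟩
  have hcl := Thompson.mem_closure_generators hg h4
  have hpos := Thompson.wordLength_pos hcl (Thompson.ne_one_of_le_leafNumber h4)
  have hX : 𝒢.generators ⊆ Thompson.Kind.V.generators := by
    intro a
    cases 𝒢 <;>
      simp only [Thompson.Kind.generators, Set.mem_insert_iff, Set.mem_singleton_iff] <;> tauto
  have hX' : ({Thompson.x₀, Thompson.x₁} : Set Thompson.CantorPerm) ⊆ 𝒢.generators := by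
    intro a
    cases 𝒢 <;>
      simp only [Thompson.Kind.generators, Set.mem_insert_iff, Set.mem_singleton_iff] <;> tauto
  obtain ⟨N, hN, hJ⟩ := Thompson.exists_joined_target hX hX' hc hcl hpos
  obtain ⟨w, hw, rfl, hw', hprod⟩ := hJ.exists_word
  generalize Thompson.wordLength 𝒢.generators g = n at *
  refine ⟨w, hw, ?_, fun v hv => ?_, ?_⟩
  · have h1 : w.length < (540 + 5 * c) * n := by
      have := Nat.mul_le_mul_left c (Nat.succ_le_of_lt hpos)
      rw [add_mul, mul_assoc]
      omega
    exact_mod_cast h1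
  · have h1 : (n : ℝ) < 4 * (Thompson.wordLength 𝒢.generators (g * v.prod) : ℝ) := by
      exact_mod_cast hw' v hv
    linarith
  · obtain ⟨k, hk⟩ : ∃ k, 20 * n = k + 2 := ⟨20 * n - 2, by omega⟩
    rw [hprod, hk, show k + 2 - 1 = k + 1 from rfl, Thompson.sub_replicate_false, inv_pow,
      ← zpow_natCast Thompson.x₀ (k + 1), ← zpow_neg]
    congr 2
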